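/- **Definitions.** Let $f_0,\dots,f_{n-1}$ be real analytic functions on an open interval $L\subset\mathbb R$. They form a *CT-system* (complete Chebyshev system) on $L$ if, for every $k=1,\dots,n$, every linear combination $\alpha_0f_0+\dots+\alpha_{k-1}f_{k-1}$ with $(\alpha_0,\dots,\alpha_{k-1})\ne0$ has at most $k-1$ zeros on $L$. They form an *ECT-system* (extended complete Chebyshev system) on $L$ if, for every $k=1,\dots,n$, every such combination has at most $k-1$ zeros on $L$ counted with multiplicities. (In particular, in both cases such a combination does not vanish identically.) The *balance* of a function $\kappa$ with respect to a map $\sigma$ is $\mathscr B_\sigma(\kappa)(x)=\kappa(x)-\kappa(\sigma(x))$. **Theorem B.** Let $m,s\ge1$ and $n\ge 0$ be integers and let $H(x,y)=A(x)+B(x)y^{2m}$ have a local minimum at the origin with $H(0,0)=0$. Let $\mathcal P$ be a punctured neighbourhood of the origin foliated by ovals $\gamma_h\subset\{H=h\}$, $h\in(0,h_0)$, where $h_0\in(0,+\infty]$; here an oval is a regular simple closed curve surrounding the origin and containing no critical point of $H$, and all ovals are oriented clockwise. Let $(x_\ell,x_r)$, $-\infty\le x_\ell<0<x_r\le+\infty$,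 be the projection of $\mathcal P$ on the $x$-axis, and let $A$, $B$ and $f_0,\dots,f_{n-1}$ be real analytic on $(x_\ell,x_r)$. Let $\sigma$ be the involution associated to $A$, that is, the analytic map $\sigma:(x_\ell,x_r)\to(x_\ell,x_r)$ with $\sigma\circ\sigma=\mathrm{Id}$, $\sigma\neq\mathrm{Id}$ and $A\circ\sigma=A$. Set $$I_i(h)=\int_{\gamma_h}f_i(x)\,y^{2s-1}\,dx,\qquad \ell_i=\mathscr B_\sigma\!\left(\frac{f_i}{A'\,B^{\frac{2s-1}{2m}}}\right),\qquad i=0,1,\dots,n-1.$$ If $s>m(n-2)$ and $(\ell_0,\dots,\ell_{n-1})$ is a CT-system on $(0,x_r)$, then $(I_0,\dots,I_{n-1})$ is an ECT-system on $(0,h_0)$; in particular the functions $I_i$ are analytic on $(0,h_0)$. -/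

import Mathlib

open Set

noncomputable section

/-- The family `(f₀, …, f_{n-1})` of real functions is a
Chebyshev system on `L`: the functions are analytic on `L` and every linear combination with
coefficients not all zero has at most `n - 1` zeros on `L`. In particular such a combination does
not vanish identically, so that (for an interval `L`) all its zeros are isolated. -/
def IsTSystem {n : ℕ} (f : Fin n → ℝ → ℝ) (L : Set ℝ) : Prop :=
  (∀ i, AnalyticOnNhd ℝ (f i) L) ∧
    ∀ α : Fin n → ℝ, α ≠ 0 →
      {x ∈ L | ∑ i, α i * f i x = 0}.encard ≤ ((n - 1 : ℕ) : ℕ∞)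

/-- Complete Chebyshev system: `(f₀, …, f_{k-1})` is a Chebyshev system for `k = 1, …, n`. -/
def IsCTSystem {n : ℕ} (f : Fin n → ℝ → ℝ) (L : Set ℝ) : Prop :=
  ∀ k : ℕ, 1 ≤ k → ∀ hk : k ≤ n, IsTSystem (fun i : Fin k => f (Fin.castLE hk i)) L

/-- The function `F` has at most `N` zeros on `L`, counted with multiplicities. The multiplicity
of a zero is the vanishing order; it is `0` at a point where `F ≠ 0`, and `⊤` where `F` vanishes
identically near the point. -/
def AtMostZerosWithMult (F : ℝ → ℝ) (L : Set ℝ) (N : ℕ) : Prop :=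
  ∀ S : Finset ℝ, (S : Set ℝ) ⊆ L → ∑ x ∈ S, analyticOrderAt F x ≤ (N : ℕ∞)

/-- Extended complete Chebyshev system: the functions are analytic on `L` and, for `k = 1, …, n`,
every linear combination of `f₀, …, f_{k-1}` with coefficients not all zero has at most `k - 1`
zeros on `L` counted with multiplicities. -/
def IsECTSystem {n : ℕ} (f : Fin n → ℝ → ℝ) (L : Set ℝ) : Prop :=
  (∀ i, AnalyticOnNhd ℝ (f i) L) ∧
    ∀ k : ℕ, 1 ≤ k → ∀ hk : k ≤ n, ∀ α : Fin k → ℝ, α ≠ 0 →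
      AtMostZerosWithMult (fun x => ∑ i, α i * f (Fin.castLE hk i) x) L (k - 1)

/-- The open interval `(a, b)` of real numbers with possibly infinite endpoints. -/
def realIoo (a b : EReal) : Set ℝ := {x | a < (x : EReal) ∧ (x : EReal) < b}

/-- The balance `κ(x) - κ(σ(x))` of `κ` with respect to `σ`. -/
def balance (σ κ : ℝ → ℝ) (x : ℝ) : ℝ := κ x - κ (σ x)

/-- `σ` is the involution associated to `A` on `J`: an analytic map `J → J` with `σ ∘ σ = id`,
`σ ≠ id` and `A ∘ σ = A` on `J`. -/
structure IsInvolutionOf (A σ : ℝ → ℝ) (J : Set ℝ) : Prop where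
  analytic : AnalyticOnNhd ℝ σ J
  mapsTo : MapsTo σ J J
  involutive : ∀ x ∈ J, σ (σ x) = x
  ne_id : ∃ x ∈ J, σ x ≠ x
  invariant : ∀ x ∈ J, A (σ x) = A x

/-- `c` (restricted to one period `[0, 1]`) is a regular `C¹` parametrization, in the clockwise
sense, of an oval surrounding the origin inside the level curve `{H = h}`. Clockwise means that
the velocity is a positive multiple of `(∂H/∂y, -∂H/∂x)`, so that points with larger values of `H`,
which are outside the oval when `H` has a minimum inside, lie on the left. The oval contains no
critical point of `H`. -/
structure IsClockwiseOval (H : ℝ × ℝ → ℝ) (h : ℝ) (c : ℝ → ℝ × ℝ) : Prop where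
  contDiff : ContDiff ℝ 1 c
  periodic : Function.Periodic c 1
  injOn : InjOn c (Ico 0 1)
  level : ∀ t, H (c t) = h
  regular : ∀ t, deriv c t ≠ 0
  clockwise : ∀ t, ∃ r : ℝ, 0 < r ∧
    deriv c t = r • (fderiv ℝ H (c t) (0, 1), -fderiv ℝ H (c t) (1, 0))
  origin_notMem : (0 : ℝ × ℝ) ∉ range c
  surrounds : Bornology.IsBounded (connectedComponentIn (range c)ᶜ (0 : ℝ × ℝ))

/-- `P` is a punctured neighbourhood of the origin, at which `H` has a local minimum with value
`0`, foliated by ovals of `H` that are parametrized by the energy levels `h ∈ (0, h₀)`; the oval of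
level `h` is the image of `γ h`. -/
structure IsPeriodAnnulus (H : ℝ × ℝ → ℝ) (P : Set (ℝ × ℝ)) (h₀ : EReal)
    (γ : ℝ → ℝ → ℝ × ℝ) : Prop where
  energy_pos : 0 < h₀
  zero_notMem : (0 : ℝ × ℝ) ∉ P
  isOpen_insert : IsOpen (insert 0 P)
  map_zero : H 0 = 0
  isLocalMin : IsLocalMin H 0
  oval : ∀ h ∈ realIoo 0 h₀, IsClockwiseOval H h (γ h)
  foliated : P = ⋃ h ∈ realIoo 0 h₀, range (γ h)

/-- The line integral of the 1-form `f(x) g(y) dx` along the closed curve `c` with period `1`. -/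
def lineIntegral (f g : ℝ → ℝ) (c : ℝ → ℝ × ℝ) : ℝ :=
  ∫ t in (0 : ℝ)..1, f (c t).1 * g (c t).2 * (deriv c t).1

end

/-!
The theorem rests on the formula `I_i(h) = 2 ∫₀^h L_i(u) (h - u) ^ e du`, where
`e = (2s - 1) / (2m)` and `L_i = ℓ_i ∘ ρ` is the balance transported to the energy axis by the
inverse `ρ` of `A` on `(0, xr)` (`exists_lineIntegral_eq_fracIntegral`). So, up to constants, the
`I_i` are fractional integrals of functions `L_i` that form a CT-system on `(0, h₀)`.

*Local bound.* Let `Φ` be a nontrivial combination of the first `k` line integrals and `Λ` the same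
combination of the `L_i`, which has at most `k - 1` zeros. If `Φ` vanished to order `k` at `h`, then
`∫₀^h Λ(u) (h - u) ^ (e - j) du = 0` for `j = 0, …, k - 1`; the hypothesis `s > m (n - 2)` says that
these exponents exceed `-1`. Hence `Λ` would be orthogonal, for the positive weight
`(h - u) ^ (e - k + 1)`, to all polynomials of degree at most `k - 1`. One of them changes sign
exactly where `Λ` does, a contradiction (`analyticOrderAt_fracIntegral_le`). So `Φ` has order less
than `k` at each point.

*Global bound.* Such pointwise bounds, for all `k ≤ n`, yield an ECT-system: dividing by the first
function and differentiating lowers both `k` and, by Rolle's theorem with multiplicities, the number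
of zeros by one (`isECTSystem_of_order_lt`). This replaces the usual passage through Wronskians.

*Geometry.* The formula requires the shape of the ovals. First `B > 0`, because a line `x = const`
on which `B` vanishes is invariant under the Hamiltonian flow (`IsLevelLoop.B_ne_zero`). Then the
sign of `x'` is that of `y`, and an oval is made of an upper and a lower arc over an interval
`[a, b]`, which are exchanged by `y ↦ -y` (`IsLevelLoop.exists_extent`). That `A` is
monotone on both sides of `0` follows because every level in `(0, h₀)` carries an oval
(`IsHalfWell.first_attained`).
-/

open MeasureTheory Filter Topology

/-! ### Counting zeros through pointwise vanishing orders -/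

/-- Rolle's theorem for a finite set of zeros: the derivative has, strictly between the zeros, at
least one zero fewer. -/
lemma exists_deriv_zeros_between {F : ℝ → ℝ} {L : Set ℝ} (hL : L.OrdConnected)
    (hF : ContinuousOn F L) (S : Finset ℝ) (hS : (S : Set ℝ) ⊆ L) (h0 : ∀ x ∈ S, F x = 0) :
    ∃ T : Finset ℝ, S.card ≤ T.card + 1 ∧ Disjoint S T ∧ (T : Set ℝ) ⊆ L ∧
      ∀ t ∈ T, deriv F t = 0 ∧ ∃ b ∈ S, t < b := by
  classical
  induction S using Finset.induction_on_max with
  | empty => exact ⟨∅, by simp⟩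
  | insert x S hx ih =>
    rw [Finset.coe_insert, insert_subset_iff] at hS
    obtain ⟨T, hc, hd, hT, hz⟩ := ih hS.2 fun y hy => h0 y (Finset.mem_insert_of_mem hy)
    have hxS : x ∉ S := fun h => lt_irrefl _ (hx x h)
    rcases S.eq_empty_or_nonempty with rfl | hne
    · exact ⟨∅, by simp⟩
    set m := S.max' hne with hm
    have hmS : m ∈ S := S.max'_mem hne
    obtain ⟨z, hz1, hz2⟩ := exists_deriv_eq_zero (hx m hmS)
      (hF.mono (hL.out (hS.2 hmS) hS.1))
      ((h0 m (Finset.mem_insert_of_mem hmS)).trans (h0 x (Finset.mem_insert_self _ _)).symm)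
    have hlt : ∀ t ∈ T, t < m := fun t ht => by
      obtain ⟨-, b, hb, htb⟩ := hz t ht
      exact htb.trans_le (S.le_max' b hb)
    have hzT : z ∉ T := fun h => (hlt z h).not_gt hz1.1
    refine ⟨insert z T, ?_, ?_, ?_, ?_⟩
    · rw [Finset.card_insert_of_notMem hzT, Finset.card_insert_of_notMem hxS]
      omega
    · rw [Finset.disjoint_left]
      intro y hy hy'
      rcases Finset.mem_insert.1 hy with rfl | hy <;> rcases Finset.mem_insert.1 hy' with rfl | hy'
      · exact lt_irrefl _ hz1.2
      · exact ((hlt _ hy').trans (hx m hmS)).false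
      · exact ((S.le_max' _ hy).trans_lt hz1.1).false
      · exact Finset.disjoint_left.1 hd hy hy'
    · rw [Finset.coe_insert, insert_subset_iff]
      exact ⟨hL.out (hS.2 hmS) hS.1 ⟨hz1.1.le, hz1.2.le⟩, hT⟩
    · intro t ht
      rcases Finset.mem_insert.1 ht with rfl | ht
      · exact ⟨hz2, x, Finset.mem_insert_self _ _, hz1.2⟩
      · obtain ⟨h1, b, hb, h2⟩ := hz t ht
        exact ⟨h1, b, Finset.mem_insert_of_mem hb, h2⟩

lemma analyticOrderAt_eq_deriv_add_one {F : ℝ → ℝ} {x : ℝ} (hF : AnalyticAt ℝ F x)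
    (h0 : F x = 0) : analyticOrderAt F x = analyticOrderAt (deriv F) x + 1 := by
  simpa [h0] using hF.analyticOrderAt_deriv_add_one.symm

/-- Rolle's theorem with multiplicities. -/
lemma AtMostZerosWithMult.of_deriv {F : ℝ → ℝ} {L : Set ℝ} (hL : L.OrdConnected)
    (hF : AnalyticOnNhd ℝ F L) {N : ℕ} (h : AtMostZerosWithMult (deriv F) L N) :
    AtMostZerosWithMult F L (N + 1) := by
  classical
  intro S hS
  set S₀ := S.filter (fun x => F x = 0) with hS₀
  have hS₀L : (S₀ : Set ℝ) ⊆ L := fun x hx => hS (Finset.mem_filter.1 hx).1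
  obtain ⟨T, hc, hd, hT, hz⟩ := exists_deriv_zeros_between hL hF.continuousOn S₀ hS₀L
    fun x hx => (Finset.mem_filter.1 hx).2
  have hsum : ∑ x ∈ S, analyticOrderAt F x = ∑ x ∈ S₀, analyticOrderAt F x := by
    symm
    refine Finset.sum_subset (Finset.filter_subset _ _) fun x hx hx' => ?_
    rw [(hF x (hS hx)).analyticOrderAt_eq_zero]
    exact fun h0 => hx' (Finset.mem_filter.2 ⟨hx, h0⟩)
  have hT1 : (T.card : ℕ∞) ≤ ∑ x ∈ T, analyticOrderAt (deriv F) x := by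
    rw [← nsmul_one, ← Finset.sum_const]
    refine Finset.sum_le_sum fun t ht => ?_
    rw [Order.one_le_iff_ne_zero]
    exact ((hF t (hT ht)).deriv.analyticOrderAt_ne_zero).2 (hz t ht).1
  have hU := h (S₀ ∪ T) (by rw [Finset.coe_union]; exact union_subset hS₀L hT)
  rw [Finset.sum_union hd] at hU
  calc ∑ x ∈ S, analyticOrderAt F x
      = ∑ x ∈ S₀, (analyticOrderAt (deriv F) x + 1) := by
        rw [hsum]
        exact Finset.sum_congr rfl fun x hx =>
          analyticOrderAt_eq_deriv_add_one (hF x (hS₀L hx)) (Finset.mem_filter.1 hx).2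
    _ = ∑ x ∈ S₀, analyticOrderAt (deriv F) x + S₀.card := by
        rw [Finset.sum_add_distrib, Finset.sum_const, nsmul_one]
    _ ≤ ∑ x ∈ S₀, analyticOrderAt (deriv F) x + (T.card + 1) := by
        gcongr
        exact_mod_cast hc
    _ ≤ (∑ x ∈ S₀, analyticOrderAt (deriv F) x + ∑ x ∈ T, analyticOrderAt (deriv F) x) + 1 := by
        rw [← add_assoc]
        gcongr
    _ ≤ ((N + 1 : ℕ) : ℕ∞) := by
        push_cast
        gcongr

lemma AtMostZerosWithMult.congr_order {F G : ℝ → ℝ} {L : Set ℝ} {N : ℕ}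
    (h : AtMostZerosWithMult F L N)
    (hFG : ∀ x ∈ L, analyticOrderAt G x = analyticOrderAt F x) : AtMostZerosWithMult G L N :=
  fun S hS => (Finset.sum_congr rfl fun x hx => hFG x (hS hx)).trans_le (h S hS)

/-- Polya's criterion without Wronskians: if the nontrivial combinations of the first `k` functions
vanish to order less than `k` at each point, for every `k`, then they have less than `k` zeros
altogether. The induction divides by the first function and differentiates. -/
lemma atMostZerosWithMult_of_order_lt {L : Set ℝ} (hLo : IsOpen L) (hL : L.OrdConnected) (n : ℕ) :
    ∀ f : Fin (n + 1) → ℝ → ℝ, (∀ i, AnalyticOnNhd ℝ (f i) L) →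
      (∀ k (hk : k ≤ n + 1) (α : Fin k → ℝ), α ≠ 0 → ∀ x ∈ L,
        analyticOrderAt (fun x => ∑ i, α i * f (Fin.castLE hk i) x) x < k) →
      ∀ α : Fin (n + 1) → ℝ, α ≠ 0 →
        AtMostZerosWithMult (fun x => ∑ i, α i * f i x) L n := by
  induction n with
  | zero =>
    intro f hf h α hα S hS
    rw [Finset.sum_eq_zero fun x hx => ?_]
    · simp
    · exact Order.lt_one_iff.1 (by simpa using h 1 le_rfl α hα x (hS hx))
  | succ n ih =>
    intro f hf h α hα
    have hf0 : ∀ x ∈ L, f 0 x ≠ 0 := by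
      intro x hx h0
      have := h 1 (by omega) (fun _ => 1) (by simp [funext_iff]) x hx
      have h1 : analyticOrderAt (fun x => f 0 x) x = 0 := by
        simpa using this
      exact ((hf 0 x hx).analyticOrderAt_eq_zero.1 h1) h0
    set q : Fin (n + 1) → ℝ → ℝ := fun i x => f i.succ x / f 0 x with hq
    have hqa : ∀ i, AnalyticOnNhd ℝ (q i) L := fun i x hx => (hf _ x hx).div (hf 0 x hx) (hf0 x hx)
    have hcomb : ∀ {k : ℕ} (β : Fin k → ℝ) (e : Fin k → Fin (n + 1)), ∀ x ∈ L,
        AnalyticAt ℝ (fun x => ∑ i, β i * q (e i) x) x := fun β e x hx =>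
      Finset.analyticAt_fun_sum _ fun i _ => analyticAt_const.mul (hqa (e i) x hx)
    have hcomb' : ∀ {k : ℕ} (a : ℝ) (β : Fin k → ℝ) (e : Fin k → Fin (n + 1)), ∀ x ∈ L,
        AnalyticAt ℝ (fun x => a + ∑ i, β i * q (e i) x) x := fun a β e x hx =>
      analyticAt_const.add (hcomb β e x hx)
    have hderiv : ∀ {k : ℕ} (β : Fin k → ℝ) (e : Fin k → Fin (n + 1)), ∀ x ∈ L,
        deriv (fun x => ∑ i, β i * q (e i) x) x = ∑ i, β i * deriv (q (e i)) x := by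
      intro k β e x hx
      rw [deriv_fun_sum fun i _ => (hqa (e i) x hx).differentiableAt.const_mul _]
      exact Finset.sum_congr rfl fun i _ => deriv_const_mul _ (hqa (e i) x hx).differentiableAt
    -- the order of `α₀ f₀ + ∑ αᵢ₊₁ fᵢ₊₁` is that of its quotient by `f₀`
    have horder : ∀ {k : ℕ} (a : ℝ) (β : Fin k → ℝ) (e : Fin k → Fin (n + 1)), ∀ x ∈ L,
        analyticOrderAt (fun x => a * f 0 x + ∑ i, β i * f (e i).succ x) x =
          analyticOrderAt (fun x => a + ∑ i, β i * q (e i) x) x := by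
      intro k a β e x hx
      have h1 : (fun x => a * f 0 x + ∑ i, β i * f (e i).succ x) =ᶠ[nhds x]
          (f 0 * fun x => a + ∑ i, β i * q (e i) x) := by
        filter_upwards [hLo.mem_nhds hx] with y hy
        simp only [Pi.mul_apply, mul_add, Finset.mul_sum, hq]
        rw [mul_comm]
        congr 1
        refine Finset.sum_congr rfl fun i _ => ?_
        field_simp [hf0 y hy]
      rw [analyticOrderAt_congr h1, analyticOrderAt_mul (hf 0 x hx)
        (hcomb' a β e x hx), ((hf 0 x hx).analyticOrderAt_eq_zero).2 (hf0 x hx),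
        zero_add]
    have hg := ih (fun i => deriv (q i)) (fun i x hx => (hqa i x hx).deriv) ?_
    · by_cases hβ : (fun i => α (Fin.succ i)) = 0
      · -- only the first function is involved
        have hα0 : α 0 ≠ 0 := fun h0 => hα <| funext fun i => by
          refine Fin.cases h0 (fun j => congrFun hβ j) i
        intro S hS
        rw [Finset.sum_eq_zero fun x hx => ?_]
        · simp
        · have hs : (fun x => ∑ i, α i * f i x) = fun x => α 0 * f 0 x := by
            funext y
            rw [Fin.sum_univ_succ, Finset.sum_eq_zero, add_zero]
            intro i _
            rw [show α i.succ = 0 from congrFun hβ i, zero_mul]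
          have ha : AnalyticAt ℝ (fun y => α 0 * f 0 y) x := analyticAt_const.mul (hf 0 x (hS hx))
          rw [hs, ha.analyticOrderAt_eq_zero]
          exact mul_ne_zero hα0 (hf0 x (hS hx))
      · have h1 := hg _ hβ
        have h2 : AtMostZerosWithMult (fun x => α 0 + ∑ i : Fin (n + 1), α i.succ * q i x) L
            (n + 1) := by
          refine AtMostZerosWithMult.of_deriv hL (fun x hx => hcomb' _ _ id x hx)
            (h1.congr_order fun x hx => ?_)
          refine analyticOrderAt_congr ?_
          filter_upwards [hLo.mem_nhds hx] with y hy
          rw [deriv_const_add]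
          exact hderiv _ id y hy
        refine h2.congr_order fun x hx => ?_
        simp_rw [Fin.sum_univ_succ (n := n + 1)]
        exact horder (α 0) (fun i => α i.succ) id x hx
    · intro k hk β hβ x hx
      set c : ℝ := ∑ i, β i * q (Fin.castLE hk i) x with hc
      have h1 := h (k + 1) (by omega) (Fin.cons (-c) β) (fun h0 => hβ <| funext fun i => by
        simpa using congrFun h0 i.succ) x hx
      simp_rw [Fin.sum_univ_succ] at h1
      simp only [Fin.cons_zero, Fin.cons_succ] at h1
      have h2 := horder (-c) β (Fin.castLE hk) x hx
      have h3 : analyticOrderAt (fun x => -c + ∑ i, β i * q (Fin.castLE hk i) x) x =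
          analyticOrderAt (fun x => ∑ i, β i * deriv (q (Fin.castLE hk i)) x) x + 1 := by
        rw [analyticOrderAt_eq_deriv_add_one (hcomb' _ _ _ x hx) (by simp [hc])]
        congr 1
        refine analyticOrderAt_congr ?_
        filter_upwards [hLo.mem_nhds hx] with y hy
        rw [deriv_const_add]
        exact hderiv _ _ y hy
      rw [h3] at h2
      have h4 : analyticOrderAt (fun x => ∑ i, β i * deriv (q (Fin.castLE hk i)) x) x + 1
          < (k : ℕ∞) + 1 := by
        rw [← h2]
        exact_mod_cast h1
      exact lt_of_add_lt_add_right h4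

lemma isECTSystem_of_order_lt {n : ℕ} {f : Fin n → ℝ → ℝ} {L : Set ℝ} (hLo : IsOpen L)
    (hL : L.OrdConnected) (hf : ∀ i, AnalyticOnNhd ℝ (f i) L)
    (h : ∀ k (hk : k ≤ n) (α : Fin k → ℝ), α ≠ 0 → ∀ x ∈ L,
      analyticOrderAt (fun x => ∑ i, α i * f (Fin.castLE hk i) x) x < k) :
    IsECTSystem f L := by
  refine ⟨hf, fun k hk1 hk α hα => ?_⟩
  obtain ⟨k, rfl⟩ : ∃ j, k = j + 1 := ⟨k - 1, by omega⟩
  exact atMostZerosWithMult_of_order_lt hLo hL k (fun i => f (Fin.castLE hk i)) (fun i => hf _)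
    (fun j hj β hβ x hx => by
      simpa [Fin.castLE_castLE] using h j (hj.trans hk) β hβ x hx) α hα

/-! ### Analyticity of integrals depending on a parameter -/

/-- A dominated integral of holomorphic functions is holomorphic in the parameter. -/
lemma analyticAt_integral_of_dominated {V : Type*} [MeasurableSpace V] {μ : Measure V}
    {F : ℂ → V → ℂ} {z₀ : ℂ} {R : ℝ} (hR : 0 < R) {bound : V → ℝ}
    (hmeas : ∀ z ∈ Metric.ball z₀ R, AEStronglyMeasurable (F z) μ)
    (hdiff : ∀ᵐ v ∂μ, DifferentiableOn ℂ (fun z => F z v) (Metric.ball z₀ R))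
    (hbound : ∀ᵐ v ∂μ, ∀ z ∈ Metric.ball z₀ R, ‖F z v‖ ≤ bound v)
    (hint : Integrable bound μ) : AnalyticAt ℂ (fun z => ∫ v, F z v ∂μ) z₀ := by
  have hd : DifferentiableOn ℂ (fun z => ∫ v, F z v ∂μ) (Metric.ball z₀ R) := by
    intro z hz
    obtain ⟨r, hr, hrb⟩ := Metric.isOpen_iff.1 Metric.isOpen_ball z hz
    have hb2 : ∀ w ∈ Metric.ball z (r / 2), ∀ ζ ∈ Metric.sphere w (r / 3),
        ζ ∈ Metric.ball z₀ R := by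
      intro w hw ζ hζ
      refine hrb ?_
      rw [Metric.mem_ball] at hw ⊢
      rw [Metric.mem_sphere] at hζ
      linarith [dist_triangle ζ w z]
    have hsub : Metric.ball z (r / 2) ⊆ Metric.ball z₀ R :=
      (Metric.ball_subset_ball (by linarith)).trans hrb
    have hcl : ∀ w ∈ Metric.ball z (r / 2), Metric.closedBall w (r / 3) ⊆ Metric.ball z₀ R := by
      intro w hw ζ hζ
      refine hrb ?_
      rw [Metric.mem_ball] at hw ⊢
      rw [Metric.mem_closedBall] at hζ
      linarith [dist_triangle ζ w z]
    have hzb : z ∈ Metric.ball z (r / 2) := Metric.mem_ball_self (by linarith)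
    -- the derivative is a limit of difference quotients along the sequence `z + r / (2 (n + 2))`
    have hmeas' : AEStronglyMeasurable (fun v => deriv (fun z => F z v) z) μ := by
      set u : ℕ → ℂ := fun n => z + ((r / 2 : ℝ) / ((n : ℝ) + 2) : ℝ) with hu
      have hu0 : ∀ n : ℕ, 0 < (r / 2 : ℝ) / ((n : ℝ) + 2) := fun n =>
        div_pos (by linarith) (by positivity)
      have hub : ∀ n, u n ∈ Metric.ball z₀ R := fun n => hsub <| by
        have h2 : (r / 2 : ℝ) / ((n : ℝ) + 2) < r / 2 :=
          div_lt_self (by linarith) (by linarith [n.cast_nonneg (α := ℝ)])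
        rw [Metric.mem_ball, dist_eq_norm, hu, add_sub_cancel_left, Complex.norm_real,
          Real.norm_eq_abs, abs_of_pos (hu0 n)]
        exact h2
      have hut : Tendsto u atTop (𝓝[≠] z) := by
        refine tendsto_nhdsWithin_iff.2 ⟨?_, Eventually.of_forall fun n => ?_⟩
        · have h1 : Tendsto (fun n : ℕ => (r / 2 : ℝ) / ((n : ℝ) + 2)) atTop (𝓝 0) :=
            tendsto_const_nhds.div_atTop
              (tendsto_atTop_add_const_right _ _ tendsto_natCast_atTop_atTop)
          have h2 := (Complex.continuous_ofReal.tendsto 0).comp h1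
          simpa [hu] using (tendsto_const_nhds (x := z)).add h2
        · intro h
          have h1 : (((r / 2 : ℝ) / ((n : ℝ) + 2) : ℝ) : ℂ) = 0 := by simpa [hu] using h
          exact (hu0 n).ne' (by exact_mod_cast h1)
      refine aestronglyMeasurable_of_tendsto_ae atTop
        (f := fun n v => slope (fun z => F z v) z (u n)) (fun n => ?_) ?_
      · simp only [slope_def_module]
        exact ((hmeas _ (hub n)).sub (hmeas _ hz)).const_smul ((u n - z)⁻¹)
      · filter_upwards [hdiff] with v hv
        have := (hv.differentiableAt (Metric.isOpen_ball.mem_nhds hz)).hasDerivAt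
        exact (hasDerivAt_iff_tendsto_slope.1 this).comp hut
    have key := hasDerivAt_integral_of_dominated_loc_of_deriv_le (μ := μ) (F := F)
      (F' := fun w v => deriv (fun z => F z v) w) (bound := fun v => bound v / (r / 3))
      (Metric.ball_mem_nhds z (by linarith : 0 < r / 2))
      (by filter_upwards [Metric.isOpen_ball.mem_nhds hz] with w hw using hmeas w hw)
      (hint.mono' (hmeas z hz) (hbound.mono fun v hv => hv z hz)) hmeas' ?_ (hint.div_const _) ?_
    · exact key.2.differentiableAt.differentiableWithinAt
    · filter_upwards [hdiff, hbound] with v hv hv' w hw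
      exact Complex.norm_deriv_le_of_forall_mem_sphere_norm_le (by linarith)
        ((hv.mono (hcl w hw)).diffContOnCl_ball (U := Metric.closedBall w (r / 3)) subset_rfl)
        fun ζ hζ => hv' ζ (hb2 w hw ζ hζ)
    · filter_upwards [hdiff] with v hv w hw
      exact (hv.differentiableAt (Metric.isOpen_ball.mem_nhds (hsub hw))).hasDerivAt
  exact hd.analyticAt (Metric.ball_mem_nhds z₀ hR)

/-- A real analytic function extends holomorphically to a complex neighbourhood. -/
lemma AnalyticAt.exists_complex_extension {f : ℝ → ℝ} {x : ℝ} (hf : AnalyticAt ℝ f x) :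
    ∃ g : ℂ → ℂ, AnalyticAt ℂ g (x : ℂ) ∧ ∀ᶠ u : ℝ in 𝓝 x, g (u : ℂ) = (f u : ℂ) := by
  obtain ⟨p, hp⟩ := hf
  obtain ⟨ρ, hρ⟩ := hp
  set q : FormalMultilinearSeries ℂ ℂ ℂ :=
    FormalMultilinearSeries.ofScalars ℂ (fun n => ((p.coeff n : ℝ) : ℂ)) with hq
  have hnorm : ∀ n, ‖q n‖ = ‖p n‖ := fun n => by
    rw [hq, FormalMultilinearSeries.ofScalars_norm, Complex.norm_real,
      FormalMultilinearSeries.norm_apply_eq_norm_coef]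
  have hrad : q.radius = p.radius := by
    simp only [FormalMultilinearSeries.radius, hnorm]
  have hqpos : 0 < q.radius := hrad ▸ hρ.r_pos.trans_le hρ.r_le
  have hqs := (q.hasFPowerSeriesOnBall hqpos).comp_sub (x : ℂ)
  rw [zero_add] at hqs
  refine ⟨_, hqs.analyticAt, ?_⟩
  have hev := hρ.eventually_hasSum_sub
  have hev2 : ∀ᶠ u : ℝ in 𝓝 x, HasSum (fun n => q n fun _ => ((u : ℂ) - x))
      (q.sum ((u : ℂ) - x)) :=
    Complex.continuous_ofReal.continuousAt.eventually hqs.eventually_hasSum_sub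
  filter_upwards [hev, hev2] with u hu hu2
  refine hu2.unique ((Complex.hasSum_ofReal.2 hu).congr_fun fun n => ?_)
  rw [hq, FormalMultilinearSeries.ofScalars_apply_eq, p.apply_eq_pow_smul_coeff]
  simp [mul_comm]

lemma AnalyticAt.rpow_const {f : ℝ → ℝ} {x : ℝ} (hf : AnalyticAt ℝ f x) (h0 : 0 < f x) (a : ℝ) :
    AnalyticAt ℝ (fun y => f y ^ a) x := by
  refine (((hf.log h0).mul analyticAt_const).rexp (f := fun y => Real.log (f y) * a)).congr ?_
  filter_upwards [hf.continuousAt.eventually (lt_mem_nhds h0)] with y hy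
  rw [Real.rpow_def_of_pos hy, Function.comp_apply]

/-! ### Fractional integrals -/

/-- Up to the factor `Γ (a + 1)`, the Riemann-Liouville fractional integral of order `a + 1` of `L`
with base point `0`. -/
noncomputable def fracIntegral (a : ℝ) (L : ℝ → ℝ) (h : ℝ) : ℝ :=
  ∫ u in (0 : ℝ)..h, L u * (h - u) ^ a

lemma rpow_le_add_of_mem_Icc {r s t : ℝ} (a : ℝ) (hr : 0 < r) (ht : t ∈ Icc r s) :
    t ^ a ≤ r ^ a + s ^ a := by
  have ht0 : 0 < t := hr.trans_le ht.1
  have hs0 : 0 < s := ht0.trans_le ht.2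
  rcases le_total 0 a with ha | ha
  · linarith [Real.rpow_le_rpow ht0.le ht.2 ha, Real.rpow_nonneg hr.le a]
  · linarith [Real.rpow_le_rpow_of_nonpos hr ht.1 ha, Real.rpow_nonneg hs0.le a]

lemma intervalIntegrable_sub_rpow {a : ℝ} (ha : -1 < a) (c h : ℝ) :
    IntervalIntegrable (fun u => (h - u) ^ a) volume c h := by
  have := ((intervalIntegral.intervalIntegrable_rpow' (a := 0) (b := h - c) ha).comp_sub_left h)
  simpa using this.symm

lemma intervalIntegrable_mul_sub_rpow {L : ℝ → ℝ} {H a h : ℝ} (ha : -1 < a)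
    (hc : ContinuousOn L (Ioo 0 H)) (hi : IntegrableOn L (Ioo 0 H)) (hh : h ∈ Ioo 0 H) :
    IntervalIntegrable (fun u => L u * (h - u) ^ a) volume 0 h := by
  have h1 : IntervalIntegrable (fun u => L u * (h - u) ^ a) volume 0 (h / 2) := by
    refine IntervalIntegrable.mul_continuousOn ?_ ?_
    · rw [intervalIntegrable_iff_integrableOn_Ioc_of_le (by linarith [hh.1])]
      exact hi.mono_set fun u hu => ⟨hu.1, by linarith [hu.2, hh.1, hh.2]⟩
    · rw [uIcc_of_le (by linarith [hh.1])]
      exact ContinuousOn.rpow_const (by fun_prop) fun u hu => Or.inl (by linarith [hu.2, hh.1])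
  refine h1.trans ((intervalIntegrable_sub_rpow ha _ _).continuousOn_mul ?_)
  rw [uIcc_of_le (by linarith [hh.1])]
  exact hc.mono fun u hu => ⟨by linarith [hu.1, hh.1], by linarith [hu.2, hh.2]⟩

/-- The part of the fractional integral away from the upper limit is analytic. -/
lemma analyticAt_integral_mul_sub_rpow {L : ℝ → ℝ} {ε h : ℝ} (a : ℝ) (hε : 0 < ε) (hεh : ε < h)
    (hi : IntegrableOn L (Ioc 0 ε)) :
    AnalyticAt ℝ (fun x => ∫ u in (0 : ℝ)..ε, L u * (x - u) ^ a) h := by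
  set R := (h - ε) / 2 with hRdef
  have hR : 0 < R := by linarith
  have hre : ∀ z ∈ Metric.ball (h : ℂ) R, ∀ u ∈ Ioc 0 ε, R < (z - u).re := by
    intro z hz u hu
    rw [Metric.mem_ball, dist_eq_norm] at hz
    have := (abs_le.1 (Complex.abs_re_le_norm (z - h))).1
    simp only [Complex.sub_re, Complex.ofReal_re] at this ⊢
    linarith [hu.2]
  have hC := analyticAt_integral_of_dominated (μ := volume.restrict (Ioc 0 ε))
    (F := fun z u => (L u : ℂ) * (z - u) ^ (a : ℂ)) (z₀ := h) (R := R) hR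
    (bound := fun u => |L u| * (R ^ a + (h + R) ^ a)) ?_ ?_ ?_ (hi.abs.mul_const _)
  · refine hC.re_ofReal.congr ?_
    filter_upwards [Metric.ball_mem_nhds h hR] with x hx
    rw [intervalIntegral.integral_of_le hε.le]
    have h1 : ∀ u ∈ Ioc 0 ε, (L u : ℂ) * ((x : ℂ) - u) ^ (a : ℂ) =
        ((L u * (x - u) ^ a : ℝ) : ℂ) := by
      intro u hu
      have hxu : 0 ≤ x - u := by
        have := (abs_lt.1 (Real.dist_eq x h ▸ Metric.mem_ball.1 hx)).1
        linarith [hu.2]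
      rw [Complex.ofReal_mul, Complex.ofReal_cpow hxu, Complex.ofReal_sub]
    rw [setIntegral_congr_fun measurableSet_Ioc h1]
    exact (congrArg Complex.re (integral_ofReal (𝕜 := ℂ))).trans (Complex.ofReal_re _)
  · intro z hz
    refine (Complex.continuous_ofReal.comp_aestronglyMeasurable hi.aestronglyMeasurable).mul ?_
    refine ContinuousOn.aestronglyMeasurable ?_ measurableSet_Ioc
    refine ContinuousOn.cpow_const (by fun_prop) fun u hu => Or.inl ?_
    exact hR.trans (hre z hz u hu)
  · filter_upwards [ae_restrict_mem measurableSet_Ioc] with u hu z hz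
    refine DifferentiableAt.differentiableWithinAt ?_
    refine (DifferentiableAt.cpow_const (by fun_prop) (Or.inl ?_)).const_mul _
    exact hR.trans (hre z hz u hu)
  · filter_upwards [ae_restrict_mem measurableSet_Ioc] with u hu z hz
    rw [norm_mul, Complex.norm_real, Real.norm_eq_abs, Complex.norm_cpow_real]
    gcongr
    refine rpow_le_add_of_mem_Icc a hR ⟨(hre z hz u hu).le.trans (Complex.re_le_norm _), ?_⟩
    rw [Metric.mem_ball, dist_eq_norm] at hz
    have h1 : ‖((h : ℂ) - u)‖ ≤ h := by
      rw [← Complex.ofReal_sub, Complex.norm_real, Real.norm_eq_abs, abs_le]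
      exact ⟨by linarith [hu.2], by linarith [hu.1]⟩
    calc ‖z - u‖ = ‖(z - h) + (h - u)‖ := by ring_nf
      _ ≤ ‖z - h‖ + ‖(h : ℂ) - u‖ := norm_add_le _ _
      _ ≤ h + R := by linarith

/-- The part of the fractional integral close to the upper limit is analytic where `L` is: the
substitution `u = ε + (x - ε) v` makes the range of integration constant. -/
lemma exists_analyticAt_integral_near {L : ℝ → ℝ} {h a : ℝ} (ha : -1 < a) (h0 : 0 < h)
    (hL : AnalyticAt ℝ L h) :
    ∃ ε ∈ Ioo 0 h, AnalyticAt ℝ (fun x => ∫ u in ε..x, L u * (x - u) ^ a) h := by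
  obtain ⟨g, hg, hgL⟩ := hL.exists_complex_extension
  have hbd : ∀ᶠ z in 𝓝 (h : ℂ), ‖g z‖ < ‖g h‖ + 1 :=
    hg.continuousAt.norm.eventually (gt_mem_nhds (by linarith))
  obtain ⟨r, hr, hball⟩ := Metric.eventually_nhds_iff_ball.1 (hg.eventually_analyticAt.and hbd)
  obtain ⟨r', hr', hball'⟩ := Metric.eventually_nhds_iff_ball.1 hgL
  set R := min (min r r') h with hRdef
  have hR : 0 < R := by positivity
  set ε := h - R / 2 with hε
  have hRh : R ≤ h := min_le_right _ _
  have hεm : ε ∈ Ioo 0 h := ⟨by linarith, by linarith⟩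
  refine ⟨ε, hεm, ?_⟩
  -- convex combinations of `ε` and a point near `h` stay in the disc of convergence
  have hmem : ∀ z ∈ Metric.ball (h : ℂ) (R / 2), ∀ v ∈ Ioc (0 : ℝ) 1,
      (ε : ℂ) + (z - ε) * v ∈ Metric.ball (h : ℂ) R := by
    intro z hz v hv
    have hz' : z ∈ Metric.ball (h : ℂ) R := Metric.ball_subset_ball (by linarith) hz
    have hε' : (ε : ℂ) ∈ Metric.ball (h : ℂ) R := by
      rw [Metric.mem_ball, Complex.dist_eq, ← Complex.ofReal_sub, Complex.norm_real,
        Real.norm_eq_abs, abs_lt]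
      constructor <;> linarith
    have := (convex_ball (h : ℂ) R) hε' hz' (by linarith [hv.2] : (0 : ℝ) ≤ 1 - v) hv.1.le
      (by ring)
    convert this using 1
    simp only [Complex.real_smul, Complex.ofReal_sub, Complex.ofReal_one]
    ring
  have hRr : Metric.ball (h : ℂ) R ⊆ Metric.ball (h : ℂ) r :=
    Metric.ball_subset_ball ((min_le_left _ _).trans (min_le_left _ _))
  have hint : IntegrableOn (fun v : ℝ => (1 - v) ^ a) (Ioc 0 1) := by
    rw [← intervalIntegrable_iff_integrableOn_Ioc_of_le zero_le_one]
    exact intervalIntegrable_sub_rpow ha 0 1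
  have hC := analyticAt_integral_of_dominated (μ := volume.restrict (Ioc (0 : ℝ) 1))
    (F := fun z v => g (ε + (z - ε) * v) * (((1 - v) ^ a : ℝ) : ℂ)) (z₀ := h) (R := R / 2)
    (half_pos hR) (bound := fun v => (‖g h‖ + 1) * (1 - v) ^ a) ?_ ?_ ?_ (hint.const_mul _)
  · have hmul : AnalyticAt ℝ (fun x : ℝ => (x - ε) ^ (a + 1)) h := by
      refine AnalyticAt.rpow_const (by fun_prop) ?_ _
      linarith [hεm.2]
    refine (hmul.mul hC.re_ofReal).congr ?_
    filter_upwards [Metric.ball_mem_nhds h (half_pos hR)] with x hx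
    have hx' := abs_lt.1 (Real.dist_eq x h ▸ Metric.mem_ball.1 hx)
    have hxε : 0 < x - ε := by linarith
    have hxz : (x : ℂ) ∈ Metric.ball (h : ℂ) (R / 2) := by
      rw [Metric.mem_ball, Complex.dist_eq, ← Complex.ofReal_sub, Complex.norm_real,
        Real.norm_eq_abs, abs_lt]
      exact hx'
    have h1 : ∀ v ∈ Ioc (0 : ℝ) 1, g (ε + ((x : ℂ) - ε) * v) * (((1 - v) ^ a : ℝ) : ℂ) =
        ((L (ε + (x - ε) * v) * (1 - v) ^ a : ℝ) : ℂ) := by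
      intro v hv
      have hm := hmem x hxz v hv
      have he : (ε : ℂ) + ((x : ℂ) - ε) * v = ((ε + (x - ε) * v : ℝ) : ℂ) := by push_cast; ring
      rw [he] at hm ⊢
      rw [hball', Complex.ofReal_mul]
      rw [Metric.mem_ball, Complex.dist_eq, ← Complex.ofReal_sub, Complex.norm_real] at hm
      exact hm.trans_le ((min_le_left _ _).trans (min_le_right _ _))
    simp only [Pi.mul_apply]
    rw [setIntegral_congr_fun measurableSet_Ioc h1]
    have h2 : (∫ v in Ioc (0 : ℝ) 1, ((L (ε + (x - ε) * v) * (1 - v) ^ a : ℝ) : ℂ)).re =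
        ∫ v in Ioc (0 : ℝ) 1, L (ε + (x - ε) * v) * (1 - v) ^ a :=
      (congrArg Complex.re (integral_ofReal (𝕜 := ℂ))).trans (Complex.ofReal_re _)
    rw [h2, ← intervalIntegral.integral_of_le zero_le_one]
    have h3 := intervalIntegral.smul_integral_comp_add_mul (a := 0) (b := 1)
      (fun u => L u * (x - u) ^ a) (x - ε) ε
    rw [mul_zero, add_zero, mul_one, add_sub_cancel, smul_eq_mul] at h3
    rw [← h3, Real.rpow_add_one hxε.ne', mul_comm ((x - ε) ^ a), mul_assoc]
    congr 1
    rw [← intervalIntegral.integral_const_mul]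
    refine intervalIntegral.integral_congr fun v hv => ?_
    rw [uIcc_of_le zero_le_one] at hv
    have h4 : x - (ε + (x - ε) * v) = (x - ε) * (1 - v) := by ring
    simp only [h4]
    rw [Real.mul_rpow hxε.le (by linarith [hv.2])]
    ring
  · intro z hz
    refine AEStronglyMeasurable.mul ?_
      (Complex.continuous_ofReal.comp_aestronglyMeasurable hint.aestronglyMeasurable)
    refine ContinuousOn.aestronglyMeasurable (fun v hv => ?_) measurableSet_Ioc
    have h1 : ContinuousAt g ((ε : ℂ) + (z - ε) * v) :=
      (hball _ (hRr (hmem z hz v hv))).1.continuousAt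
    exact (ContinuousAt.comp (f := fun v : ℝ => (ε : ℂ) + (z - ε) * v) h1
      (by fun_prop)).continuousWithinAt
  · filter_upwards [ae_restrict_mem measurableSet_Ioc] with v hv z hz
    refine DifferentiableAt.differentiableWithinAt (DifferentiableAt.mul_const ?_ _)
    have h1 : DifferentiableAt ℂ g ((ε : ℂ) + (z - ε) * v) :=
      (hball _ (hRr (hmem z hz v hv))).1.differentiableAt
    exact DifferentiableAt.comp (f := fun z : ℂ => (ε : ℂ) + (z - ε) * v) z h1 (by fun_prop)
  · filter_upwards [ae_restrict_mem measurableSet_Ioc] with v hv z hz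
    have h1 : (0 : ℝ) ≤ (1 - v) ^ a := Real.rpow_nonneg (by linarith [hv.2]) _
    rw [norm_mul, Complex.norm_real, Real.norm_eq_abs, abs_of_nonneg h1]
    gcongr
    exact (hball _ (hRr (hmem z hz v hv))).2.le

lemma analyticOnNhd_fracIntegral {L : ℝ → ℝ} {H a : ℝ} (ha : -1 < a)
    (hL : AnalyticOnNhd ℝ L (Ioo 0 H)) (hi : IntegrableOn L (Ioo 0 H)) :
    AnalyticOnNhd ℝ (fracIntegral a L) (Ioo 0 H) := by
  intro h hh
  obtain ⟨ε, hε, h2⟩ := exists_analyticAt_integral_near ha hh.1 (hL h hh)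
  have h1 := analyticAt_integral_mul_sub_rpow a hε.1 hε.2
    (hi.mono_set fun u hu => ⟨hu.1, hu.2.trans_lt (hε.2.trans hh.2)⟩)
  refine (h1.add h2).congr ?_
  filter_upwards [Ioo_mem_nhds hε.2 hh.2] with x hx
  have h3 := intervalIntegrable_mul_sub_rpow ha hL.continuousOn hi
    (⟨hε.1.trans hx.1, hx.2⟩ : x ∈ Ioo 0 H)
  have hxm : ε ∈ uIcc 0 x := by
    rw [uIcc_of_le (hε.1.trans hx.1).le]
    exact ⟨hε.1.le, hx.1.le⟩
  exact intervalIntegral.integral_add_adjacent_intervals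
    (h3.mono_set (uIcc_subset_uIcc left_mem_uIcc hxm))
    (h3.mono_set (uIcc_subset_uIcc hxm right_mem_uIcc))

/-- The fractional integrals of consecutive orders are primitives of each other. -/
lemma integral_fracIntegral {L : ℝ → ℝ} {T a : ℝ} (ha : -1 < a) (hT : 0 < T)
    (hi : IntegrableOn L (Ioc 0 T)) :
    IntervalIntegrable (fracIntegral a L) volume 0 T ∧
      (a + 1) * ∫ h in (0 : ℝ)..T, fracIntegral a L h = fracIntegral (a + 1) L T := by
  set K : ℝ → ℝ := (Ioc 0 T).indicator (fun w => w ^ a) with hK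
  have hKi : Integrable K := by
    rw [hK, integrable_indicator_iff measurableSet_Ioc,
      ← intervalIntegrable_iff_integrableOn_Ioc_of_le hT.le]
    exact intervalIntegral.intervalIntegrable_rpow' ha
  have hLi : Integrable ((Ioc 0 T).indicator L) := hi.integrable_indicator measurableSet_Ioc
  have hprod := (hLi.convolution_integrand (ContinuousLinearMap.mul ℝ ℝ) hKi)
  simp only [ContinuousLinearMap.mul_apply'] at hprod
  have hprod' : Integrable (fun p : ℝ × ℝ => (Ioc 0 T).indicator L p.2 * K (p.1 - p.2))
      ((volume.restrict (Ioc 0 T)).prod volume) :=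
    hprod.mono_measure (Measure.prod_mono Measure.restrict_le_self le_rfl)
  have hinner : ∀ h ∈ Ioc 0 T,
      ∫ u, (Ioc 0 T).indicator L u * K (h - u) = fracIntegral a L h := by
    intro h hh
    rw [fracIntegral, intervalIntegral.integral_of_le hh.1.le, integral_Ioc_eq_integral_Ioo,
      ← integral_indicator measurableSet_Ioo]
    congr 1
    funext u
    simp only [hK, indicator_apply, mem_Ioc, mem_Ioo]
    by_cases h1 : 0 < u
    · by_cases h2 : u < h
      · have : 0 < h - u := by linarith
        simp [h1, h2, this, (h2.trans_le hh.2).le, show h ≤ T + u by linarith [hh.2]]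
      · have : ¬ (0 < h - u) := by linarith
        simp [h2]
    · simp [h1]
  have hinner' : ∀ u ∈ Ioc 0 T, ∫ h in Ioc 0 T, K (h - u) = (T - u) ^ (a + 1) / (a + 1) := by
    intro u hu
    have h1 : ∫ h in Ioc 0 T, K (h - u) = ∫ h in u..T, (h - u) ^ a := by
      rw [intervalIntegral.integral_of_le hu.2, ← integral_indicator measurableSet_Ioc,
        ← integral_indicator measurableSet_Ioc]
      congr 1
      funext h
      simp only [hK, indicator_apply, mem_Ioc, sub_pos]
      by_cases h1 : u < h
      · by_cases h2 : h ≤ T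
        · simp [h1, h2, hu.1.trans h1, show h ≤ T + u by linarith [hu.1]]
        · simp [h2]
      · simp [h1]
    rw [h1, intervalIntegral.integral_comp_sub_right (fun h => h ^ a), sub_self,
      integral_rpow (Or.inl ha), Real.zero_rpow (by linarith), sub_zero]
  refine ⟨?_, ?_⟩
  · rw [intervalIntegrable_iff_integrableOn_Ioc_of_le hT.le]
    refine (hprod'.integral_prod_left).congr ?_
    filter_upwards [ae_restrict_mem measurableSet_Ioc] with h hh using hinner h hh
  · rw [intervalIntegral.integral_of_le hT.le, ← setIntegral_congr_fun measurableSet_Ioc hinner,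
      integral_integral_swap hprod', fracIntegral, intervalIntegral.integral_of_le hT.le,
      ← integral_const_mul, ← integral_indicator measurableSet_Ioc]
    congr 1
    funext u
    rw [integral_const_mul]
    by_cases hu : u ∈ Ioc 0 T
    · rw [hinner' u hu, indicator_of_mem hu, indicator_of_mem hu]
      field_simp [show a + 1 ≠ 0 by linarith]
    · simp [hu]

lemma hasDerivAt_fracIntegral {L : ℝ → ℝ} {H a h : ℝ} (ha : -1 < a)
    (hL : AnalyticOnNhd ℝ L (Ioo 0 H)) (hi : IntegrableOn L (Ioo 0 H)) (hh : h ∈ Ioo 0 H) :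
    HasDerivAt (fracIntegral (a + 1) L) ((a + 1) * fracIntegral a L h) h := by
  have han := analyticOnNhd_fracIntegral ha hL hi
  have hsub : ∀ T ∈ Ioo 0 H, IntegrableOn L (Ioc 0 T) := fun T hT =>
    hi.mono_set fun u hu => ⟨hu.1, hu.2.trans_lt hT.2⟩
  have h1 := intervalIntegral.integral_hasDerivAt_right
    (integral_fracIntegral ha hh.1 (hsub h hh)).1
    (han.continuousOn.stronglyMeasurableAtFilter isOpen_Ioo h hh) (han h hh).continuousAt
  refine (h1.const_mul (a + 1)).congr_of_eventuallyEq ?_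
  filter_upwards [isOpen_Ioo.mem_nhds hh] with T hT
  exact (integral_fracIntegral ha hT.1 (hsub T hT)).2.symm

/-- If the fractional integral with exponent `e + k` vanishes to order `k + 1` at `h`, then those
with exponents `e + k, e + k - 1, …, e`, its derivatives up to nonzero factors, vanish at `h`. The
condition `e > -1` makes the last one converge. -/
lemma fracIntegral_eq_zero_of_le_order {L : ℝ → ℝ} {H h : ℝ}
    (hL : AnalyticOnNhd ℝ L (Ioo 0 H)) (hi : IntegrableOn L (Ioo 0 H)) (hh : h ∈ Ioo 0 H) (k : ℕ) :
    ∀ e : ℝ, -1 < e → ((k + 1 : ℕ) : ℕ∞) ≤ analyticOrderAt (fracIntegral (e + k) L) h →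
      ∀ i ≤ k, fracIntegral (e + i) L h = 0 := by
  induction k with
  | zero =>
    intro e he ho i hi'
    obtain rfl : i = 0 := by omega
    exact apply_eq_zero_of_analyticOrderAt_ne_zero
      (Order.one_le_iff_ne_zero.1 (by simpa using ho))
  | succ k ih =>
    intro e he ho i hik
    have hpos : -1 < e + k := by linarith [k.cast_nonneg (α := ℝ)]
    have h0 : fracIntegral (e + (k + 1 : ℕ)) L h = 0 :=
      apply_eq_zero_of_analyticOrderAt_ne_zero fun h0 => by
        rw [h0] at ho
        simp at ho
    rcases Nat.lt_or_eq_of_le hik with hlt | rfl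
    · refine ih e he ?_ i (by omega)
      have hek : e + ((k + 1 : ℕ) : ℝ) = e + k + 1 := by push_cast; ring
      rw [hek] at ho h0
      have han : AnalyticAt ℝ (fracIntegral (e + k + 1) L) h :=
        analyticOnNhd_fracIntegral (by linarith) hL hi h hh
      rw [analyticOrderAt_eq_deriv_add_one han h0] at ho
      have hd : deriv (fracIntegral (e + k + 1) L) =ᶠ[𝓝 h]
          ((fun _ => e + k + 1) * fracIntegral (e + k) L) := by
        filter_upwards [isOpen_Ioo.mem_nhds hh] with x hx
        exact (hasDerivAt_fracIntegral hpos hL hi hx).deriv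
      rw [analyticOrderAt_congr hd, analyticOrderAt_mul analyticAt_const
        (analyticOnNhd_fracIntegral hpos hL hi h hh),
        (analyticAt_const.analyticOrderAt_eq_zero).2 (by linarith), zero_add] at ho
      push_cast at ho ⊢
      exact (ENat.add_le_add_iff_right ENat.one_ne_top).1 ho
    · exact h0

/-! ### Orthogonality to polynomials -/

/-- A continuous function with finitely many zeros has the signs of a polynomial whose degree is at
most their number: it vanishes at the zeros where the function changes sign. -/
lemma exists_polynomial_mul_pos {L : ℝ → ℝ} {a b : ℝ} (hL : ContinuousOn L (Ioo a b))
    (Z : Finset ℝ) (hZ : ∀ x ∈ Ioo a b, L x = 0 → x ∈ Z) :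
    ∃ p : Polynomial ℝ, p.natDegree ≤ Z.card ∧ (∀ x, p.eval x = 0 → x ∈ Z) ∧
      ∀ x ∈ Ioo a b, x ∉ Z → 0 < p.eval x * L x := by
  classical
  -- a function without zeros on an interval has constant sign there
  have hsign : ∀ {g : ℝ → ℝ} {c d : ℝ}, ContinuousOn g (Ioo c d) → (∀ x ∈ Ioo c d, g x ≠ 0) →
      (∀ x ∈ Ioo c d, 0 < g x) ∨ (∀ x ∈ Ioo c d, g x < 0) := by
    intro g c d hg h0
    by_contra! hcon
    obtain ⟨⟨x, hx, hgx⟩, y, hy, hgy⟩ := hcon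
    obtain ⟨z, hz, hz0⟩ := isPreconnected_Ioo.intermediate_value hx hy hg ⟨hgx, hgy⟩
    exact h0 z hz hz0
  induction Z using Finset.induction_on_max generalizing b with
  | empty =>
    rcases hsign hL (fun x hx h0 => by simpa using hZ x hx h0) with h | h
    · exact ⟨1, by simp, by simp, fun x hx _ => by simpa using h x hx⟩
    · exact ⟨-1, by simp, by simp, fun x hx _ => by simpa using h x hx⟩
  | insert c Z hc ih =>
    have hcZ : c ∉ Z := fun h => lt_irrefl _ (hc c h)
    have hsub : Ioo a (min b c) ⊆ Ioo a b := Ioo_subset_Ioo_right (min_le_left _ _)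
    obtain ⟨p, hp1, hp2, hp3⟩ := ih (b := min b c) (hL.mono hsub) fun x hx h0 => by
      rcases Finset.mem_insert.1 (hZ x (hsub hx) h0) with rfl | h
      · exact absurd hx.2 (not_lt.2 (min_le_right _ _))
      · exact h
    rw [Finset.card_insert_of_notMem hcZ]
    have hright : Ioo (max a c) b ⊆ Ioo a b := Ioo_subset_Ioo_left (le_max_left _ _)
    have hgt : ∀ x ∈ Ioo (max a c) b, x ∉ insert c Z := by
      intro x hx h
      have hcx : c < x := (le_max_right _ _).trans_lt hx.1
      rcases Finset.mem_insert.1 h with rfl | h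
      · exact lt_irrefl _ hcx
      · exact lt_asymm hcx (hc x h)
    have hsplit : ∀ x ∈ Ioo a b, x ∉ insert c Z →
        (x ∈ Ioo a (min b c) ∧ x ∉ Z) ∨ x ∈ Ioo (max a c) b := by
      intro x hx hxZ
      rw [Finset.mem_insert, not_or] at hxZ
      rcases lt_or_gt_of_ne hxZ.1 with h | h
      · exact Or.inl ⟨⟨hx.1, lt_min hx.2 h⟩, hxZ.2⟩
      · exact Or.inr ⟨max_lt hx.1 h, hx.2⟩
    rcases hsign (g := fun x => p.eval x * L x) (p.continuous.continuousOn.mul (hL.mono hright))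
      (fun x hx h0 => by
        rcases mul_eq_zero.1 h0 with h0 | h0
        · exact hgt x hx (Finset.mem_insert_of_mem (hp2 x h0))
        · exact hgt x hx (hZ x (hright hx) h0)) with h | h
    · refine ⟨p, by omega, fun x hx => Finset.mem_insert_of_mem (hp2 x hx), fun x hx hxZ => ?_⟩
      rcases hsplit x hx hxZ with ⟨h1, h2⟩ | h1
      · exact hp3 x h1 h2
      · exact h x h1
    · refine ⟨p * (Polynomial.C c - Polynomial.X), ?_, fun x hx => ?_, fun x hx hxZ => ?_⟩
      · refine Polynomial.natDegree_mul_le.trans (add_le_add hp1 ?_)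
        exact (Polynomial.natDegree_sub_le _ _).trans (by simp)
      · simp only [Polynomial.eval_mul, Polynomial.eval_sub, Polynomial.eval_C, Polynomial.eval_X,
          mul_eq_zero, sub_eq_zero] at hx
        rcases hx with hx | rfl
        · exact Finset.mem_insert_of_mem (hp2 x hx)
        · exact Finset.mem_insert_self _ _
      · simp only [Polynomial.eval_mul, Polynomial.eval_sub, Polynomial.eval_C, Polynomial.eval_X]
        rw [mul_right_comm]
        rcases hsplit x hx hxZ with ⟨h1, h2⟩ | h1
        · exact mul_pos (hp3 x h1 h2) (sub_pos.2 (h1.2.trans_le (min_le_right _ _)))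
        · exact mul_pos_of_neg_of_neg (h x h1) (sub_neg.2 ((le_max_right _ _).trans_lt h1.1))

/-- The order of vanishing of a fractional integral of `L` is at most the number of zeros of `L`.
Otherwise `L` would be orthogonal, for the weight `(h - u) ^ e`, to all polynomials of
degree `≤ k`, one of which has the signs of `L`. -/
lemma analyticOrderAt_fracIntegral_le {L : ℝ → ℝ} {H h : ℝ}
    (hL : AnalyticOnNhd ℝ L (Ioo 0 H)) (hi : IntegrableOn L (Ioo 0 H)) (hh : h ∈ Ioo 0 H)
    {k : ℕ} {e : ℝ} (he : -1 < e) (hk : {u ∈ Ioo 0 H | L u = 0}.encard ≤ k) :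
    analyticOrderAt (fracIntegral (e + k) L) h < (k + 1 : ℕ) := by
  by_contra! hcon
  have hzero := fracIntegral_eq_zero_of_le_order hL hi hh k e he hcon
  have hfin : {u ∈ Ioo 0 H | L u = 0}.Finite :=
    Set.finite_of_encard_le_coe hk
  set Z := hfin.toFinset with hZ
  have hZc : Z.card ≤ k := by
    rw [hfin.encard_eq_coe_toFinset_card] at hk
    exact_mod_cast hk
  have hsub : Ioo 0 h ⊆ Ioo 0 H := Ioo_subset_Ioo_right hh.2.le
  obtain ⟨p, hp1, hp2, hp3⟩ := exists_polynomial_mul_pos (hL.continuousOn.mono hsub) Z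
    fun x hx h0 => by simpa [hZ] using ⟨hsub hx, h0⟩
  set q : Polynomial ℝ := p.comp (Polynomial.C h - Polynomial.X) with hq
  have hqd : q.natDegree ≤ k := by
    refine Polynomial.natDegree_comp_le.trans ?_
    have : (Polynomial.C h - Polynomial.X : Polynomial ℝ).natDegree ≤ 1 :=
      (Polynomial.natDegree_sub_le _ _).trans (by simp)
    nlinarith
  have hqe : ∀ u, q.eval (h - u) = p.eval u := fun u => by simp [hq]
  have hint : ∀ i : ℕ, IntervalIntegrable (fun u => L u * (h - u) ^ (e + i)) volume 0 h := fun i =>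
    intervalIntegrable_mul_sub_rpow (by linarith [i.cast_nonneg (α := ℝ)]) hL.continuousOn hi hh
  -- expand `p` in powers of `h - u`
  have hexp : ∀ u ∈ Ioo 0 h, p.eval u * L u * (h - u) ^ e =
      ∑ i ∈ Finset.range (k + 1), q.coeff i * (L u * (h - u) ^ (e + i)) := by
    intro u hu
    rw [← hqe, Polynomial.eval_eq_sum_range' (Nat.lt_succ_of_le hqd), mul_assoc, Finset.sum_mul]
    refine Finset.sum_congr rfl fun i _ => ?_
    rw [Real.rpow_add (by linarith [hu.2]), Real.rpow_natCast]
    ring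
  have hIoo : ∀ F : ℝ → ℝ, ∫ u in (0 : ℝ)..h, F u = ∫ u in Ioo 0 h, F u := fun F => by
    rw [intervalIntegral.integral_of_le hh.1.le, integral_Ioc_eq_integral_Ioo]
  have hintS : IntegrableOn
      (fun u => ∑ i ∈ Finset.range (k + 1), q.coeff i * (L u * (h - u) ^ (e + i))) (Ioo 0 h) := by
    refine integrable_finsetSum _ fun i _ => Integrable.const_mul ?_ _
    exact ((intervalIntegrable_iff_integrableOn_Ioc_of_le hh.1.le).1 (hint i)).mono_set
      Ioo_subset_Ioc_self
  have hint0 : ∫ u in Ioo 0 h, p.eval u * L u * (h - u) ^ e = 0 := by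
    rw [setIntegral_congr_fun measurableSet_Ioo hexp, ← hIoo,
      intervalIntegral.integral_finsetSum fun i _ => (hint i).const_mul _]
    refine Finset.sum_eq_zero fun i hi' => ?_
    rw [intervalIntegral.integral_const_mul]
    have := hzero i (by simpa [Nat.lt_succ_iff] using hi')
    rw [fracIntegral] at this
    rw [this, mul_zero]
  have hae : ∀ᵐ u ∂(volume.restrict (Ioo 0 h)), u ∉ Z :=
    ae_restrict_of_ae (Z.finite_toSet.measure_zero volume |> measure_eq_zero_iff_ae_notMem.1)
  have hpos : ∀ᵐ u ∂(volume.restrict (Ioo 0 h)), 0 < p.eval u * L u * (h - u) ^ e := by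
    filter_upwards [hae, ae_restrict_mem measurableSet_Ioo] with u hu hu'
    exact mul_pos (hp3 u hu' hu) (Real.rpow_pos_of_pos (by linarith [hu'.2]) _)
  have hintp : Integrable (fun u => p.eval u * L u * (h - u) ^ e) (volume.restrict (Ioo 0 h)) :=
    (integrableOn_congr_fun hexp measurableSet_Ioo).2 hintS
  have h0 := (integral_eq_zero_iff_of_nonneg_ae (hpos.mono fun u hu => hu.le) hintp).1 hint0
  have hfalse : ∀ᵐ u ∂(volume.restrict (Ioo 0 h)), False := by
    filter_upwards [h0, hpos] with u h1 h2 using h2.ne' h1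
  rw [eventually_false_iff_eq_bot, ae_eq_bot, Measure.restrict_eq_zero, Real.volume_Ioo] at hfalse
  simp at hfalse
  linarith [hh.1]

/-! ### Three facts of one-variable calculus -/

/-- A periodic continuous function attains its maximum. -/
lemma Function.Periodic.exists_forall_le {g : ℝ → ℝ} (hp : Function.Periodic g 1)
    (hg : Continuous g) : ∃ t₀, ∀ t, g t ≤ g t₀ := by
  obtain ⟨t₀, -, ht₀⟩ := isCompact_Icc.exists_isMaxOn (nonempty_Icc.2 (zero_le_one (α := ℝ)))
    hg.continuousOn
  refine ⟨t₀, fun t => ?_⟩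
  obtain ⟨y, hy, hy'⟩ := hp.exists_mem_Ico₀ one_pos t
  rw [hy']
  exact ht₀ ⟨hy.1, hy.2.le⟩

/-- A function whose derivative is controlled by the function itself vanishes near its zeros. -/
lemma eventually_eq_zero_of_deriv_isBigO {g : ℝ → ℝ} {t₁ : ℝ} (hg : Differentiable ℝ g)
    (h0 : g t₁ = 0) (hO : deriv g =O[𝓝 t₁] g) : ∀ᶠ t in 𝓝 t₁, g t = 0 := by
  obtain ⟨K, hK, hO⟩ := hO.exists_pos
  obtain ⟨ε, hε, hb⟩ := Metric.eventually_nhds_iff.1 hO.bound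
  set δ := min (ε / 2) (1 / (2 * K)) with hδ
  have hδ0 : 0 < δ := by positivity
  have hδK : δ * K ≤ 1 / 2 := by
    have : δ * K ≤ 1 / (2 * K) * K := by gcongr; exact min_le_right _ _
    refine this.trans_eq ?_
    field_simp
  set I := Metric.closedBall t₁ δ with hI
  obtain ⟨τ, hτ, hmax⟩ := (isCompact_closedBall t₁ δ).exists_isMaxOn
    (Metric.nonempty_closedBall.2 hδ0.le) hg.continuous.norm.continuousOn
  have hle : ∀ t ∈ I, ‖g t‖ ≤ K * ‖g τ‖ * δ := by
    intro t ht
    have h1 := (convex_closedBall t₁ δ).norm_image_sub_le_of_norm_deriv_le (f := g)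
      (C := K * ‖g τ‖) (fun x _ => hg x) (fun x hx => ?_) (Metric.mem_closedBall_self hδ0.le) ht
    · rw [h0, sub_zero] at h1
      refine h1.trans ?_
      gcongr
      exact ht
    · refine (hb (lt_of_le_of_lt hx ?_)).trans ?_
      · exact (min_le_left _ _).trans_lt (by linarith)
      · gcongr
        exact hmax hx
  have hτ0 : ‖g τ‖ = 0 := by
    have := hle τ hτ
    nlinarith [norm_nonneg (g τ)]
  filter_upwards [Metric.closedBall_mem_nhds t₁ hδ0] with t ht
  have := hle t ht
  rw [hτ0, mul_zero, zero_mul] at this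
  exact norm_le_zero_iff.1 this

/-- The first zero after a zero with negative derivative. -/
lemma exists_next_zero {g : ℝ → ℝ} {t₀ g' : ℝ} (hg : Continuous g) (h0 : g t₀ = 0)
    (hd : HasDerivAt g g' t₀) (hg' : g' < 0) (h1 : g (t₀ + 1) = 0) :
    ∃ t₁ ∈ Ioc t₀ (t₀ + 1), g t₁ = 0 ∧ ∀ t ∈ Ioo t₀ t₁, g t < 0 := by
  have hev : ∀ᶠ t in 𝓝[>] t₀, g t < 0 := by
    have h2 := (hasDerivAt_iff_tendsto_slope.1 hd).eventually (gt_mem_nhds hg')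
    have h3 : ∀ᶠ t in 𝓝[>] t₀, slope g t₀ t < 0 :=
      h2.filter_mono (nhdsWithin_mono _ fun t (ht : t₀ < t) => ht.ne')
    filter_upwards [h3, self_mem_nhdsWithin] with t ht ht'
    rw [slope_def_field, h0, sub_zero] at ht
    have h4 : 0 < t - t₀ := sub_pos.2 ht'
    by_contra! hcon
    exact absurd ht (not_lt.2 (div_nonneg hcon h4.le))
  obtain ⟨b, hb, hbs⟩ := mem_nhdsGT_iff_exists_Ioo_subset.1 hev
  have hb0 : t₀ < b := hb
  set d := min ((t₀ + b) / 2) (t₀ + 1) with hd'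
  have hd0 : t₀ < d := lt_min (by linarith) (by linarith)
  have hdb : d < b := (min_le_left _ _).trans_lt (by linarith)
  obtain ⟨t₁, ⟨ht₁, ht₁0⟩, hleast⟩ :=
    (isCompact_Icc.inter_right (isClosed_eq hg continuous_const)).exists_isLeast
      (⟨t₀ + 1, ⟨min_le_right _ _, le_rfl⟩, h1⟩ : (Icc d (t₀ + 1) ∩ {t | g t = 0}).Nonempty)
  refine ⟨t₁, ⟨hd0.trans_le ht₁.1, ht₁.2⟩, ht₁0, fun t ht => ?_⟩
  rcases lt_or_ge t b with htb | htb
  · exact hbs ⟨ht.1, htb⟩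
  · by_contra! hcon
    obtain ⟨z, hz, hz0⟩ := intermediate_value_Icc (hdb.le.trans htb) hg.continuousOn
      (⟨(hbs ⟨hd0, hdb⟩ : g d < 0).le, hcon⟩ : (0 : ℝ) ∈ Icc (g d) (g t))
    exact absurd (hleast ⟨⟨hz.1, hz.2.trans (ht.2.le.trans ht₁.2)⟩, hz0⟩)
      (not_le.2 (hz.2.trans_lt ht.2))

/-! ### The geometry of a single oval -/

/-- A closed level curve `t ↦ (X t, Y t)` of energy `h` of `A(x) + B(x) y ^ (2m)`, over the open
set `J` of the `x`-axis and simple of period `1`, that follows the Hamiltonian direction field and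
meets no critical point. -/
structure IsLevelLoop (A B : ℝ → ℝ) (J : Set ℝ) (m : ℕ) (h : ℝ) (X Y : ℝ → ℝ) : Prop where
  contDiff_fst : ContDiff ℝ 1 X
  contDiff_snd : ContDiff ℝ 1 Y
  periodic_fst : Function.Periodic X 1
  periodic_snd : Function.Periodic Y 1
  eq_add_int : ∀ s t, X s = X t → Y s = Y t → ∃ n : ℤ, t = s + n
  mem : ∀ t, X t ∈ J
  level : ∀ t, A (X t) + B (X t) * Y t ^ (2 * m) = h
  flow : ∀ t, ∃ r, 0 < r ∧ deriv X t = r * (B (X t) * (2 * m * Y t ^ (2 * m - 1))) ∧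
    deriv Y t = -(r * (deriv A (X t) + deriv B (X t) * Y t ^ (2 * m)))
  regular : ∀ t, deriv X t = 0 → deriv Y t ≠ 0

lemma fderiv_hamiltonian {A B : ℝ → ℝ} {p : ℝ × ℝ} (m : ℕ) (hA : DifferentiableAt ℝ A p.1)
    (hB : DifferentiableAt ℝ B p.1) :
    fderiv ℝ (fun p : ℝ × ℝ => A p.1 + B p.1 * p.2 ^ (2 * m)) p (0, 1) =
        B p.1 * (2 * m * p.2 ^ (2 * m - 1)) ∧
      fderiv ℝ (fun p : ℝ × ℝ => A p.1 + B p.1 * p.2 ^ (2 * m)) p (1, 0) =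
        deriv A p.1 + deriv B p.1 * p.2 ^ (2 * m) := by
  have h1 : HasFDerivAt (fun p : ℝ × ℝ => A p.1) _ p :=
    hA.hasDerivAt.hasFDerivAt.comp p hasFDerivAt_fst
  have h2 : HasFDerivAt (fun p : ℝ × ℝ => B p.1) _ p :=
    hB.hasDerivAt.hasFDerivAt.comp p hasFDerivAt_fst
  have h3 : HasFDerivAt (fun p : ℝ × ℝ => p.2 ^ (2 * m)) _ p :=
    (hasDerivAt_pow (2 * m) p.2).hasFDerivAt.comp p hasFDerivAt_snd
  have h4 := (h1.add (h2.mul h3)).fderiv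
  have h5 : (fun p : ℝ × ℝ => A p.1 + B p.1 * p.2 ^ (2 * m)) =
    ((fun p : ℝ × ℝ => A p.1) + (fun p => B p.1) * fun p => p.2 ^ (2 * m)) := rfl
  rw [h5, h4]
  constructor
  · simp
  · simp [mul_comm]

lemma IsClockwiseOval.isLevelLoop {A B : ℝ → ℝ} {J : Set ℝ} {m : ℕ} {h : ℝ} {c : ℝ → ℝ × ℝ}
    (hc : IsClockwiseOval (fun p : ℝ × ℝ => A p.1 + B p.1 * p.2 ^ (2 * m)) h c)
    (hA : AnalyticOnNhd ℝ A J) (hB : AnalyticOnNhd ℝ B J) (hJ : ∀ t, (c t).1 ∈ J) :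
    IsLevelLoop A B J m h (fun t => (c t).1) (fun t => (c t).2) ∧
      ∀ t, (deriv c t).1 = deriv (fun t => (c t).1) t := by
  have hd : ∀ t, DifferentiableAt ℝ c t := fun t => hc.contDiff.differentiable one_ne_zero t
  have hd1 : ∀ t, deriv (fun t => (c t).1) t = (deriv c t).1 := fun t =>
    ((hasFDerivAt_fst (𝕜 := ℝ) (p := c t)).comp_hasDerivAt t (hd t).hasDerivAt).deriv
  have hd2 : ∀ t, deriv (fun t => (c t).2) t = (deriv c t).2 := fun t =>
    ((hasFDerivAt_snd (𝕜 := ℝ) (p := c t)).comp_hasDerivAt t (hd t).hasDerivAt).deriv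
  refine ⟨?_, fun t => (hd1 t).symm⟩
  exact
  { contDiff_fst := contDiff_fst.comp hc.contDiff
    contDiff_snd := contDiff_snd.comp hc.contDiff
    periodic_fst := fun t => by simp only [hc.periodic t]
    periodic_snd := fun t => by simp only [hc.periodic t]
    eq_add_int := by
      intro s t h1 h2
      have hfr : ∀ s, c (Int.fract s) = c s := fun s => by
        have := hc.periodic.sub_int_mul_eq (x := s) ⌊s⌋
        rwa [mul_one] at this
      have h3 : c (Int.fract s) = c (Int.fract t) := by
        rw [hfr, hfr]
        exact Prod.ext h1 h2
      have h4 := hc.injOn ⟨Int.fract_nonneg s, Int.fract_lt_one s⟩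
        ⟨Int.fract_nonneg t, Int.fract_lt_one t⟩ h3
      refine ⟨⌊t⌋ - ⌊s⌋, ?_⟩
      rw [Int.fract, Int.fract] at h4
      push_cast
      linarith
    mem := hJ
    level := hc.level
    flow := by
      intro t
      obtain ⟨r, hr, h1⟩ := hc.clockwise t
      obtain ⟨h2, h3⟩ := fderiv_hamiltonian m (hA _ (hJ t)).differentiableAt
        (hB _ (hJ t)).differentiableAt
      refine ⟨r, hr, ?_, ?_⟩
      · rw [hd1, h1, h2]
        simp
      · rw [hd2, h1, h3, Prod.smul_snd, smul_eq_mul, mul_neg]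
    regular := by
      intro t h1 h2
      rw [hd1] at h1
      rw [hd2] at h2
      exact hc.regular t (Prod.ext h1 h2) }

namespace IsLevelLoop

variable {A B : ℝ → ℝ} {J : Set ℝ} {m : ℕ} {h : ℝ} {X Y : ℝ → ℝ}

lemma hasDerivAt_fst (H : IsLevelLoop A B J m h X Y) (t : ℝ) : HasDerivAt X (deriv X t) t :=
  (H.contDiff_fst.differentiable one_ne_zero t).hasDerivAt

lemma hasDerivAt_snd (H : IsLevelLoop A B J m h X Y) (t : ℝ) : HasDerivAt Y (deriv Y t) t :=
  (H.contDiff_snd.differentiable one_ne_zero t).hasDerivAt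

/-- A level loop does not meet the lines where `B` vanishes: these lines are invariant under the
Hamiltonian flow, so that the loop would be contained in one of them. -/
lemma B_ne_zero (H : IsLevelLoop A B J m h X Y) (hA : AnalyticOnNhd ℝ A J)
    (hB : AnalyticOnNhd ℝ B J) (t₀ : ℝ) : B (X t₀) ≠ 0 := by
  intro hB0
  have hXc : Continuous X := H.contDiff_fst.continuous
  have hYc : Continuous Y := H.contDiff_snd.continuous
  have hclopen : IsClopen {t | X t = X t₀} := by
    refine ⟨isClosed_eq hXc continuous_const, isOpen_iff_mem_nhds.2 fun t₁ ht₁ => ?_⟩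
    have hx : X t₁ = X t₀ := ht₁
    have hX0 : deriv X t₁ = 0 := by
      obtain ⟨r, hr, h1, -⟩ := H.flow t₁
      rw [h1, hx, hB0, zero_mul, mul_zero]
    have hAc : ContinuousAt (fun t => deriv A (X t)) t₁ :=
      ContinuousAt.comp (f := X) (hA _ (H.mem t₁)).deriv.continuousAt hXc.continuousAt
    have hBc : ContinuousAt (fun t => deriv B (X t)) t₁ :=
      ContinuousAt.comp (f := X) (hB _ (H.mem t₁)).deriv.continuousAt hXc.continuousAt
    set w : ℝ → ℝ := fun t => deriv A (X t) + deriv B (X t) * Y t ^ (2 * m) with hw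
    have hwc : ContinuousAt w t₁ := hAc.add (hBc.mul (hYc.pow _).continuousAt)
    have hw0 : w t₁ ≠ 0 := by
      obtain ⟨r, hr, -, h2⟩ := H.flow t₁
      intro h0
      exact H.regular t₁ hX0 (by rw [h2]; simp only [hw] at h0; rw [h0]; simp)
    have hev : deriv X =ᶠ[𝓝 t₁] fun t =>
        (-(deriv Y t) / w t * (2 * m * Y t ^ (2 * m - 1))) * B (X t) := by
      filter_upwards [hwc.eventually_ne hw0] with t ht
      obtain ⟨r, hr, h1, h2⟩ := H.flow t
      rw [h1, h2]
      simp only [hw] at ht ⊢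
      field_simp
    have hcoef : ContinuousAt (fun t => -(deriv Y t) / w t * (2 * m * Y t ^ (2 * m - 1))) t₁ := by
      refine ((H.contDiff_snd.continuous_deriv le_rfl).continuousAt.neg.div hwc hw0).mul ?_
      exact (continuous_const.mul (hYc.pow _)).continuousAt
    have hBO : (fun t => B (X t)) =O[𝓝 t₁] fun t => X t - X t₀ := by
      have h1 := (hB _ (H.mem t₀)).differentiableAt.isBigO_sub
      simp only [hB0, sub_zero] at h1
      have h2 : Tendsto X (𝓝 t₁) (𝓝 (X t₀)) := hx ▸ hXc.continuousAt
      exact h1.comp_tendsto h2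
    have hO : deriv (fun t => X t - X t₀) =O[𝓝 t₁] fun t => X t - X t₀ := by
      have h1 : deriv (fun t => X t - X t₀) = deriv X := by
        funext t
        exact deriv_sub_const _
      rw [h1]
      have h2 := (hcoef.tendsto.isBigO_one ℝ).mul hBO
      simp only [one_mul] at h2
      exact hev.trans_isBigO h2
    filter_upwards [eventually_eq_zero_of_deriv_isBigO
      ((H.contDiff_fst.differentiable one_ne_zero).sub_const _) (sub_eq_zero.2 hx) hO] with t ht
    exact sub_eq_zero.1 ht
  have huniv : {t | X t = X t₀} = univ := hclopen.eq_univ ⟨t₀, rfl⟩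
  have hconst : X = fun _ => X t₀ := funext fun t => eq_univ_iff_forall.1 huniv t
  obtain ⟨τ, hτ⟩ := H.periodic_snd.exists_forall_le hYc
  refine H.regular τ (by rw [hconst]; simp) ?_
  exact IsLocalMax.deriv_eq_zero (Eventually.of_forall hτ)

lemma deriv_fst_pos (H : IsLevelLoop A B J m h X Y) (hm : 1 ≤ m) (hB : ∀ x ∈ J, 0 < B x) {t : ℝ}
    (ht : 0 < Y t) : 0 < deriv X t := by
  obtain ⟨r, hr, h1, -⟩ := H.flow t
  have := hB _ (H.mem t)
  have hm' : (0 : ℝ) < m := by exact_mod_cast hm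
  rw [h1]
  positivity

lemma deriv_fst_neg (H : IsLevelLoop A B J m h X Y) (hm : 1 ≤ m) (hB : ∀ x ∈ J, 0 < B x) {t : ℝ}
    (ht : Y t < 0) : deriv X t < 0 := by
  obtain ⟨r, hr, h1, -⟩ := H.flow t
  have hB' := hB _ (H.mem t)
  have hm' : (0 : ℝ) < m := by exact_mod_cast hm
  have hodd : Odd (2 * m - 1) := ⟨m - 1, by omega⟩
  have := hodd.pow_neg ht
  rw [h1]
  refine mul_neg_of_pos_of_neg hr (mul_neg_of_pos_of_neg hB' (mul_neg_of_pos_of_neg ?_ this))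
  positivity

/-- At the points of the `x`-axis the loop is vertical, and crosses the axis in the direction
given by the sign of `A'`. -/
lemma deriv_of_snd_eq_zero (H : IsLevelLoop A B J m h X Y) (hm : 1 ≤ m) {t : ℝ} (ht : Y t = 0) :
    A (X t) = h ∧ deriv Y t ≠ 0 ∧ ∃ r, 0 < r ∧ deriv Y t = -(r * deriv A (X t)) := by
  obtain ⟨r, hr, h1, h2⟩ := H.flow t
  have h3 : 2 * m - 1 ≠ 0 := by omega
  have h4 : 2 * m ≠ 0 := by omega
  refine ⟨?_, ?_, r, hr, ?_⟩
  · simpa [ht, h4] using H.level t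
  · exact H.regular t (by rw [h1, ht, zero_pow h3]; ring)
  · rw [h2, ht, zero_pow h4]
    ring

lemma A_lt_of_snd_ne_zero (H : IsLevelLoop A B J m h X Y) (hB : ∀ x ∈ J, 0 < B x) {t : ℝ}
    (ht : Y t ≠ 0) : A (X t) < h := by
  have h1 := H.level t
  have h2 : 0 < Y t ^ (2 * m) := by
    rw [pow_mul]
    positivity
  nlinarith [mul_pos (hB _ (H.mem t)) h2]

/-- A level loop in a strip where `B > 0` consists of an upper arc, on which `x` increases, and of a
lower arc, on which `x` decreases. -/
lemma exists_arcs (H : IsLevelLoop A B J m h X Y) (hm : 1 ≤ m) (hB : ∀ x ∈ J, 0 < B x) :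
    ∃ tm t₀, tm < t₀ ∧ t₀ < tm + 1 ∧ Y tm = 0 ∧ Y t₀ = 0 ∧ (∀ t ∈ Ioo tm t₀, 0 < Y t) ∧
      (∀ t ∈ Ioo t₀ (tm + 1), Y t < 0) ∧ StrictMonoOn X (Icc tm t₀) ∧ (∀ t, X t ≤ X t₀) ∧
      (∀ t, X tm ≤ X t) ∧ 0 < deriv A (X t₀) ∧ deriv A (X tm) < 0 := by
  have hXc : Continuous X := H.contDiff_fst.continuous
  have hYc : Continuous Y := H.contDiff_snd.continuous
  obtain ⟨t₀, ht₀⟩ := H.periodic_fst.exists_forall_le hXc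
  have hmono : ∀ {a b : ℝ}, (∀ t ∈ Ioo a b, 0 < Y t) → StrictMonoOn X (Icc a b) := by
    intro a b hab
    refine strictMonoOn_of_deriv_pos (convex_Icc a b) hXc.continuousOn fun t ht => ?_
    rw [interior_Icc] at ht
    exact H.deriv_fst_pos hm hB (hab t ht)
  have hanti : ∀ {a b : ℝ}, (∀ t ∈ Ioo a b, Y t < 0) → StrictAntiOn X (Icc a b) := by
    intro a b hab
    refine strictAntiOn_of_deriv_neg (convex_Icc a b) hXc.continuousOn fun t ht => ?_
    rw [interior_Icc] at ht
    exact H.deriv_fst_neg hm hB (hab t ht)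
  have hX0 : deriv X t₀ = 0 := IsLocalMax.deriv_eq_zero (Eventually.of_forall ht₀)
  have hY0 : Y t₀ = 0 := by
    rcases lt_trichotomy (Y t₀) 0 with h1 | h1 | h1
    · exact absurd hX0 (H.deriv_fst_neg hm hB h1).ne
    · exact h1
    · exact absurd hX0 (H.deriv_fst_pos hm hB h1).ne'
  obtain ⟨hA0, hY0', r, hr, hYr⟩ := H.deriv_of_snd_eq_zero hm hY0
  have hYneg : deriv Y t₀ < 0 := by
    by_contra! hcon
    have hpos : 0 < deriv Y t₀ := lt_of_le_of_ne hcon hY0'.symm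
    obtain ⟨t₁, ht₁, -, hlt⟩ := exists_next_zero (g := fun t => -Y t) hYc.neg (by simp [hY0])
      (H.hasDerivAt_snd t₀).neg (by linarith) (by simp [H.periodic_snd t₀, hY0])
    have := hmono (a := t₀) (b := t₁) fun t ht => by simpa using hlt t ht
    exact absurd (ht₀ t₁) (not_le.2 (this ⟨le_rfl, ht₁.1.le⟩ ⟨ht₁.1.le, le_rfl⟩ ht₁.1))
  have hApos : 0 < deriv A (X t₀) := by
    by_contra! hcon
    nlinarith
  obtain ⟨tp, htp, hYp, hneg⟩ := exists_next_zero hYc hY0 (H.hasDerivAt_snd t₀) hYneg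
    (by rw [H.periodic_snd t₀, hY0])
  obtain ⟨τ, hτ, hYτ, hτneg⟩ := exists_next_zero (g := fun s => -Y (-s)) (t₀ := -t₀)
    (g' := deriv Y t₀) (hYc.comp continuous_neg).neg (by simp [hY0])
    (by
      have h1 : HasDerivAt Y (deriv Y t₀) (- -t₀) := by rw [neg_neg]; exact H.hasDerivAt_snd t₀
      have h2 := (h1.comp (-t₀) (hasDerivAt_neg (-t₀))).neg
      rw [mul_neg_one, neg_neg] at h2
      exact h2) hYneg
    (by
      have := H.periodic_snd (-(-t₀ + 1))
      rw [show -(-t₀ + 1) + 1 = t₀ by ring, hY0] at this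
      rw [← this, neg_zero])
  set tm := -τ with htm
  have hYm : Y tm = 0 := by simpa using hYτ
  have hpos : ∀ t ∈ Ioo tm t₀, 0 < Y t := fun t ht => by
    simpa using hτneg (-t) ⟨by linarith [ht.2], by linarith [ht.1]⟩
  have hlt : tm < t₀ := by linarith [hτ.1]
  have hXmono := hmono hpos
  have hXanti := hanti hneg
  have hAp := (H.deriv_of_snd_eq_zero hm hYp).1
  have hAm := (H.deriv_of_snd_eq_zero hm hYm).1
  have hXmlt : X tm < X t₀ := hXmono ⟨le_rfl, hlt.le⟩ ⟨hlt.le, le_rfl⟩ hlt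
  have hXplt : X tp < X t₀ := hXanti ⟨le_rfl, htp.1.le⟩ ⟨htp.1.le, le_rfl⟩ htp.1
  -- both arcs end at the last point before `X t₀` where `A = h`
  have hXeq : X tm = X tp := by
    rcases lt_trichotomy (X tm) (X tp) with h1 | h1 | h1
    · obtain ⟨t, ht, hXt⟩ := intermediate_value_Ioo hlt.le hXc.continuousOn ⟨h1, hXplt⟩
      have := H.A_lt_of_snd_ne_zero hB (hpos t ht).ne'
      rw [hXt, hAp] at this
      exact absurd this (lt_irrefl _)
    · exact h1
    · obtain ⟨t, ht, hXt⟩ := intermediate_value_Ioo' htp.1.le hXc.continuousOn ⟨h1, hXmlt⟩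
      have := H.A_lt_of_snd_ne_zero hB (hneg t ht).ne
      rw [hXt, hAm] at this
      exact absurd this (lt_irrefl _)
  obtain ⟨n, hn⟩ := H.eq_add_int tm tp hXeq (by rw [hYm, hYp])
  have hn1 : n = 1 := by
    have h1 : (0 : ℝ) < n := by linarith [htp.1]
    have h2 : (n : ℝ) ≤ 2 := by linarith [htp.2, hτ.2]
    have h3 : 0 < n := by exact_mod_cast h1
    have h4 : n ≤ 2 := by exact_mod_cast h2
    have h5 : n ≠ 2 := by
      rintro rfl
      have h6 : tp = t₀ + 1 := by
        push_cast at hn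
        linarith [htp.2, hτ.2]
      rw [h6, H.periodic_fst t₀] at hXplt
      exact lt_irrefl _ hXplt
    omega
  have htpeq : tp = tm + 1 := by rw [hn, hn1]; simp
  have hAmneg : deriv A (X tm) < 0 := by
    obtain ⟨-, hYm', r', hr', hYr'⟩ := H.deriv_of_snd_eq_zero hm hYm
    have : 0 ≤ deriv Y tm := by
      by_contra! hcon
      obtain ⟨t₁, ht₁, -, hlt'⟩ := exists_next_zero hYc hYm (H.hasDerivAt_snd tm) hcon
        (by rw [H.periodic_snd tm, hYm])
      obtain ⟨t, ht, ht'⟩ := exists_between (lt_min ht₁.1 hlt)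
      exact lt_asymm (hpos t ⟨ht, ht'.trans_le (min_le_right _ _)⟩)
        (hlt' t ⟨ht, ht'.trans_le (min_le_left _ _)⟩)
    have h2 : 0 < deriv Y tm := lt_of_le_of_ne this hYm'.symm
    by_contra! hcon
    nlinarith
  have hmin : ∀ t, X tm ≤ X t := by
    intro t
    obtain ⟨y, hy, hy'⟩ := H.periodic_fst.exists_mem_Ico one_pos t tm
    rw [hy']
    rcases le_total y t₀ with h1 | h1
    · exact hXmono.monotoneOn ⟨le_rfl, hlt.le⟩ ⟨hy.1, h1⟩ hy.1
    · rw [hXeq]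
      exact hXanti.antitoneOn ⟨h1, by rw [htpeq]; exact hy.2.le⟩ ⟨htp.1.le, le_rfl⟩
        (by rw [htpeq]; exact hy.2.le)
  exact ⟨tm, t₀, hlt, htpeq ▸ htp.1, hYm, hY0, hpos, htpeq ▸ hneg, hXmono, ht₀, hmin, hApos, hAmneg⟩

/-- The line integral along a level loop, in terms of the interval `[a, b]` of the `x`-axis over
which it lies: the upper and the lower arc contribute the same amount. -/
lemma exists_extent (H : IsLevelLoop A B J m h X Y) (hm : 1 ≤ m) (hA : ContinuousOn A J)
    (hBc : ContinuousOn B J) (hB : ∀ x ∈ J, 0 < B x) :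
    ∃ a b, a < b ∧ Icc a b ⊆ J ∧ (∀ x ∈ Ioo a b, A x < h) ∧ A a = h ∧ A b = h ∧
      deriv A a < 0 ∧ 0 < deriv A b ∧ (∀ t, X t ∈ Icc a b) ∧
      ∀ f : ℝ → ℝ, ContinuousOn f J → ∀ s : ℕ, 1 ≤ s →
        ∫ t in (0 : ℝ)..1, f (X t) * Y t ^ (2 * s - 1) * deriv X t =
          2 * ∫ x in a..b, f x * ((h - A x) / B x) ^ ((2 * (s : ℝ) - 1) / (2 * (m : ℝ))) := by
  obtain ⟨tm, t₀, htm, htp, hYm, hY0, hpos, hneg, hmono, hmax, hmin, hA0, hAm⟩ := H.exists_arcs hm hB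
  have hXc : Continuous X := H.contDiff_fst.continuous
  have hYc : Continuous Y := H.contDiff_snd.continuous
  have hper : X (tm + 1) = X tm := H.periodic_fst tm
  have himg : ∀ x ∈ Icc (X tm) (X t₀), ∃ t ∈ Icc tm t₀, X t = x := fun x hx =>
    intermediate_value_Icc htm.le hXc.continuousOn hx
  have hsub : Icc (X tm) (X t₀) ⊆ J := fun x hx => by
    obtain ⟨t, -, rfl⟩ := himg x hx
    exact H.mem t
  refine ⟨X tm, X t₀, hmono ⟨le_rfl, htm.le⟩ ⟨htm.le, le_rfl⟩ htm, hsub, ?_,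
    (H.deriv_of_snd_eq_zero hm hYm).1, (H.deriv_of_snd_eq_zero hm hY0).1, hAm, hA0,
    fun t => ⟨hmin t, hmax t⟩, ?_⟩
  · intro x hx
    obtain ⟨t, ht, rfl⟩ := intermediate_value_Ioo htm.le hXc.continuousOn hx
    exact H.A_lt_of_snd_ne_zero hB (hpos t ht).ne'
  · intro f hf s hs
    set e : ℝ := (2 * (s : ℝ) - 1) / (2 * (m : ℝ)) with he
    have hm0 : (0 : ℝ) < m := by exact_mod_cast hm
    have hs1 : (1 : ℝ) ≤ s := by exact_mod_cast hs
    have he0 : 0 ≤ e := by rw [he]; apply div_nonneg <;> linarith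
    set G : ℝ → ℝ := fun x => f x * ((h - A x) / B x) ^ e with hG
    have hGc : ContinuousOn G J := hf.mul
      (((continuousOn_const.sub hA).div hBc fun x hx => (hB x hx).ne').rpow_const
        fun x _ => Or.inr he0)
    -- on the curve, the power of `(h - A) / B` is a power of `|y|`
    have hpow : ∀ t, ((h - A (X t)) / B (X t)) ^ e = |Y t| ^ (2 * s - 1) := by
      intro t
      have h1 : (h - A (X t)) / B (X t) = |Y t| ^ (2 * m) := by
        rw [div_eq_iff (hB _ (H.mem t)).ne', ← H.level t, (even_two_mul m).pow_abs]
        ring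
      rw [h1, ← Real.rpow_natCast, ← Real.rpow_mul (abs_nonneg _), ← Real.rpow_natCast]
      congr 1
      rw [he, Nat.cast_sub (by omega)]
      push_cast
      field_simp
    have hodd : Odd (2 * s - 1) := ⟨s - 1, by omega⟩
    have hup : ∀ t ∈ Icc tm t₀, f (X t) * Y t ^ (2 * s - 1) * deriv X t = G (X t) * deriv X t := by
      intro t ht
      have h0 : 0 ≤ Y t := by
        rcases eq_or_lt_of_le ht.1 with rfl | h1
        · exact hYm.ge
        · rcases eq_or_lt_of_le ht.2 with rfl | h2
          · exact hY0.ge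
          · exact (hpos t ⟨h1, h2⟩).le
      simp only [hG, hpow, abs_of_nonneg h0]
    have hdown : ∀ t ∈ Icc t₀ (tm + 1),
        f (X t) * Y t ^ (2 * s - 1) * deriv X t = -(G (X t) * deriv X t) := by
      intro t ht
      have h0 : Y t ≤ 0 := by
        rcases eq_or_lt_of_le ht.1 with rfl | h1
        · exact hY0.le
        · rcases eq_or_lt_of_le ht.2 with rfl | h2
          · rw [H.periodic_snd tm, hYm]
          · exact (hneg t ⟨h1, h2⟩).le
      simp only [hG, hpow, abs_of_nonpos h0, hodd.neg_pow]
      ring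
    have hsubst : ∀ a b, ∫ t in a..b, G (X t) * deriv X t = ∫ x in X a..X b, G x := fun a b =>
      intervalIntegral.integral_comp_mul_deriv''' hXc.continuousOn
        (fun t _ => (H.hasDerivAt_fst t).hasDerivWithinAt)
        (hGc.mono (by rintro _ ⟨t, -, rfl⟩; exact H.mem t))
        ((hGc.mono (by rintro _ ⟨t, -, rfl⟩; exact H.mem t) :
          ContinuousOn G (X '' uIcc a b)).integrableOn_compact
            (isCompact_uIcc.image hXc))
        ((((hGc.comp_continuous hXc H.mem).mul
          (H.contDiff_fst.continuous_deriv le_rfl)).continuousOn).integrableOn_compact isCompact_uIcc)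
    have hcont : Continuous fun t => f (X t) * Y t ^ (2 * s - 1) * deriv X t :=
      ((hf.comp_continuous hXc H.mem).mul (hYc.pow _)).mul
        (H.contDiff_fst.continuous_deriv le_rfl)
    have hP : Function.Periodic (fun t => f (X t) * Y t ^ (2 * s - 1) * deriv X t) 1 := by
      intro t
      have h1 : deriv X (t + 1) = deriv X t := by
        have h2 : (fun u => X (u + 1)) = X := funext H.periodic_fst
        rw [← deriv_comp_add_const, h2]
      simp only [H.periodic_fst t, H.periodic_snd t, h1]
    have h1 := hP.intervalIntegral_add_eq 0 tm
    rw [zero_add] at h1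
    rw [h1, ← intervalIntegral.integral_add_adjacent_intervals (hcont.intervalIntegrable tm t₀)
      (hcont.intervalIntegrable t₀ (tm + 1))]
    rw [intervalIntegral.integral_congr (a := tm) (b := t₀) (g := fun t => G (X t) * deriv X t)
        (by rw [uIcc_of_le htm.le]; exact hup),
      intervalIntegral.integral_congr (a := t₀) (g := fun t => -(G (X t) * deriv X t))
        (by rw [uIcc_of_le htp.le]; exact hdown),
      intervalIntegral.integral_neg, hsubst, hsubst, hper, intervalIntegral.integral_symm (X tm)]
    ring

end IsLevelLoop

/-! ### The period annulus -/

lemma isOpen_realIoo (a b : EReal) : IsOpen (realIoo a b) :=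
  isOpen_Ioo.preimage continuous_coe_real_ereal

lemma ordConnected_realIoo (a b : EReal) : (realIoo a b).OrdConnected :=
  ⟨fun _ hx _ hy _ hz => ⟨hx.1.trans_le (EReal.coe_le_coe_iff.2 hz.1),
    (EReal.coe_le_coe_iff.2 hz.2).trans_lt hy.2⟩⟩

section Extent

variable {A B : ℝ → ℝ} {m : ℕ} {P : Set (ℝ × ℝ)} {h₀ xl xr : EReal} {γ : ℝ → ℝ → ℝ × ℝ}

lemma A_zero_eq_zero (hm : 1 ≤ m)
    (hP : IsPeriodAnnulus (fun p : ℝ × ℝ => A p.1 + B p.1 * p.2 ^ (2 * m)) P h₀ γ) : A 0 = 0 := by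
  have h1 : 2 * m ≠ 0 := by omega
  simpa [h1] using hP.map_zero

lemma mem_iff_exists_oval {H : ℝ × ℝ → ℝ} (hP : IsPeriodAnnulus H P h₀ γ) {p : ℝ × ℝ} :
    p ∈ P ↔ ∃ h ∈ realIoo 0 h₀, ∃ t, γ h t = p := by
  rw [hP.foliated]
  simp

/-- Points close to the origin, other than the origin, belong to the period annulus. -/
lemma eventually_mem_annulus {H : ℝ × ℝ → ℝ} (hP : IsPeriodAnnulus H P h₀ γ) {g : ℝ → ℝ × ℝ}
    (hg : Continuous g) (h0 : g 0 = 0) (hne : ∀ x ≠ 0, g x ≠ 0) :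
    ∀ᶠ x in 𝓝[≠] (0 : ℝ), g x ∈ P := by
  have h1 : ∀ᶠ x in 𝓝 (0 : ℝ), g x ∈ insert 0 P :=
    hg.continuousAt.eventually (h0.symm ▸ hP.isOpen_insert.mem_nhds (mem_insert _ _))
  filter_upwards [h1.filter_mono nhdsWithin_le_nhds, self_mem_nhdsWithin] with x hx hx'
  exact hx.resolve_left (hne x hx')

lemma zero_mem_realIoo {H : ℝ × ℝ → ℝ} (hP : IsPeriodAnnulus H P h₀ γ)
    (hproj : Prod.fst '' P = realIoo xl xr) : (0 : ℝ) ∈ realIoo xl xr := by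
  obtain ⟨y, hy⟩ := (eventually_mem_annulus hP (g := fun y => ((0 : ℝ), y)) (by fun_prop) rfl
    fun y hy h => hy (congrArg Prod.snd h)).exists
  rw [← hproj]
  exact ⟨_, hy, rfl⟩

lemma fst_mem_realIoo {H : ℝ × ℝ → ℝ} (hP : IsPeriodAnnulus H P h₀ γ)
    (hproj : Prod.fst '' P = realIoo xl xr) {h : ℝ} (hh : h ∈ realIoo 0 h₀) (t : ℝ) :
    (γ h t).1 ∈ realIoo xl xr := by
  rw [← hproj]
  exact ⟨_, (mem_iff_exists_oval hP).2 ⟨h, hh, t, rfl⟩, rfl⟩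

lemma B_pos (hm : 1 ≤ m)
    (hP : IsPeriodAnnulus (fun p : ℝ × ℝ => A p.1 + B p.1 * p.2 ^ (2 * m)) P h₀ γ)
    (hproj : Prod.fst '' P = realIoo xl xr) (hA : AnalyticOnNhd ℝ A (realIoo xl xr))
    (hB : AnalyticOnNhd ℝ B (realIoo xl xr)) : ∀ x ∈ realIoo xl xr, 0 < B x := by
  have hne : ∀ x ∈ realIoo xl xr, B x ≠ 0 := by
    intro x hx
    rw [← hproj] at hx
    obtain ⟨p, hp, rfl⟩ := hx
    obtain ⟨h, hh, t, rfl⟩ := (mem_iff_exists_oval hP).1 hp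
    exact (((hP.oval h hh).isLevelLoop hA hB (fst_mem_realIoo hP hproj hh)).1).B_ne_zero hA hB t
  have hB0 : 0 < B 0 := by
    obtain ⟨y, hy⟩ := (eventually_mem_annulus hP (g := fun y => ((0 : ℝ), y)) (by fun_prop) rfl
      fun y hy h => hy (congrArg Prod.snd h)).exists
    obtain ⟨h, hh, t, ht⟩ := (mem_iff_exists_oval hP).1 hy
    have h1 := (hP.oval h hh).level t
    have h2 : (0 : ℝ) < h := by exact_mod_cast hh.1
    simp only [ht, A_zero_eq_zero hm hP, zero_add] at h1
    have h3 : 0 ≤ y ^ (2 * m) := (even_two_mul m).pow_nonneg y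
    by_contra! hcon
    nlinarith
  intro x hx
  by_contra! hcon
  obtain ⟨z, hz, hz0⟩ := (ordConnected_realIoo xl xr).isPreconnected.intermediate_value hx
    (zero_mem_realIoo hP hproj) hB.continuousOn ⟨hcon, hB0.le⟩
  exact hne z hz hz0

/-- Each oval lies over an interval `[a, b]` that contains `0` in its interior, because an oval that
missed the `y`-axis would not surround the origin. -/
lemma exists_oval_extent (hm : 1 ≤ m)
    (hP : IsPeriodAnnulus (fun p : ℝ × ℝ => A p.1 + B p.1 * p.2 ^ (2 * m)) P h₀ γ)
    (hproj : Prod.fst '' P = realIoo xl xr) (hA : AnalyticOnNhd ℝ A (realIoo xl xr))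
    (hB : AnalyticOnNhd ℝ B (realIoo xl xr)) {h : ℝ} (hh : h ∈ realIoo 0 h₀) :
    ∃ a b, a < 0 ∧ 0 < b ∧ Icc a b ⊆ realIoo xl xr ∧ (∀ x ∈ Ioo a b, A x < h) ∧ A a = h ∧
      A b = h ∧ deriv A a < 0 ∧ 0 < deriv A b ∧ (∀ t, (γ h t).1 ∈ Icc a b) ∧
      ∀ f : ℝ → ℝ, ContinuousOn f (realIoo xl xr) → ∀ s : ℕ, 1 ≤ s →
        lineIntegral f (fun y => y ^ (2 * s - 1)) (γ h) =
          2 * ∫ x in a..b, f x * ((h - A x) / B x) ^ ((2 * (s : ℝ) - 1) / (2 * (m : ℝ))) := by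
  obtain ⟨H, hder⟩ := (hP.oval h hh).isLevelLoop hA hB (fst_mem_realIoo hP hproj hh)
  obtain ⟨a, b, hab, hsub, hlt, hAa, hAb, hda, hdb, hmem, hint⟩ :=
    H.exists_extent hm hA.continuousOn hB.continuousOn (B_pos hm hP hproj hA hB)
  have hpos : (0 : ℝ) < h := by exact_mod_cast hh.1
  have hA0 := A_zero_eq_zero hm hP
  have h0 : (0 : ℝ) ∈ Icc a b := by
    by_contra hcon
    -- the `y`-axis is connected, avoids the oval and is unbounded
    have hline : ((fun y : ℝ => ((0 : ℝ), y)) '' univ) ⊆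
        connectedComponentIn (range (γ h))ᶜ (0 : ℝ × ℝ) := by
      refine IsPreconnected.subset_connectedComponentIn
        (isPreconnected_univ.image _ (by fun_prop)) ⟨0, mem_univ _, rfl⟩ ?_
      rintro _ ⟨y, -, rfl⟩ ⟨t, ht⟩
      refine hcon ?_
      have := hmem t
      simpa only [ht] using this
    have hbdd := ((hP.oval h hh).surrounds.subset hline).image_snd
    rw [image_image, image_univ, range_id'] at hbdd
    exact NormedSpace.unbounded_univ ℝ ℝ hbdd
  have ha0 : a < 0 := lt_of_le_of_ne h0.1 (by rintro rfl; linarith)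
  have hb0 : 0 < b := lt_of_le_of_ne h0.2 (by rintro rfl; linarith)
  refine ⟨a, b, ha0, hb0, hsub, hlt, hAa, hAb, hda, hdb, hmem, fun f hf s hs => ?_⟩
  rw [lineIntegral, ← hint f hf s hs]
  simp only [hder]

end Extent

/-! ### The two branches of the inverse of `A` -/

/-- One side of the period annulus, the points `x > 0` of the open set `J`, where `J` contains `0`:
each level `h` of `T = (0, h₀)` is first attained by `A` at some point of `J` with `A' > 0`, and
`J` is exhausted by the segments `[0, b]` that end at such points. -/
structure IsHalfWell (A : ℝ → ℝ) (J : Set ℝ) (h₀ : EReal) : Prop where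
  isOpen : IsOpen J
  analytic : AnalyticOnNhd ℝ A J
  map_zero : A 0 = 0
  eventually_pos : ∀ᶠ x in 𝓝[>] (0 : ℝ), 0 < A x
  exists_first : ∀ h ∈ realIoo 0 h₀, ∃ b, 0 < b ∧ Icc 0 b ⊆ J ∧ (∀ x ∈ Ico 0 b, A x < h) ∧
    A b = h ∧ 0 < deriv A b
  exhausted : ∀ x ∈ J, 0 < x → ∃ h ∈ realIoo 0 h₀, ∃ b, x ≤ b ∧ Icc 0 b ⊆ J ∧
    (∀ x ∈ Ico 0 b, A x < h) ∧ A b = h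

namespace IsHalfWell

variable {A : ℝ → ℝ} {J : Set ℝ} {h₀ : EReal}

/-- Every point `x > 0` is the first one where its level is attained: the first point that attains
the maximum of `A` over `[0, x]` is `x`, for `A` exceeds the maximum immediately after it. -/
lemma first_attained (W : IsHalfWell A J h₀) {x : ℝ} (hx : x ∈ J) (hx0 : 0 < x) :
    A x ∈ realIoo 0 h₀ ∧ 0 < deriv A x ∧ Icc 0 x ⊆ J ∧ ∀ y ∈ Ico 0 x, A y < A x := by
  obtain ⟨h, hh, b, hxb, hbJ, hbA, hAb⟩ := W.exhausted x hx hx0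
  have hsub : Icc 0 x ⊆ J := (Icc_subset_Icc_right hxb).trans hbJ
  obtain ⟨y, hy, hmax⟩ := isCompact_Icc.exists_isMaxOn (nonempty_Icc.2 hx0.le)
    (W.analytic.continuousOn.mono hsub)
  have hMh : A y ≤ h := by
    rcases eq_or_lt_of_le (hy.2.trans hxb) with h1 | h1
    · rw [h1, hAb]
    · exact (hbA y ⟨hy.1, h1⟩).le
  have hM0 : 0 < A y := by
    obtain ⟨z, hz, hz'⟩ := (W.eventually_pos.and (Ioo_mem_nhdsGT hx0)).exists
    exact hz.trans_le (hmax ⟨hz'.1.le, hz'.2.le⟩)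
  have hM : A y ∈ realIoo 0 h₀ :=
    ⟨by exact_mod_cast hM0, (EReal.coe_le_coe_iff.2 hMh).trans_lt hh.2⟩
  obtain ⟨c, hc0, hcJ, hcA, hAc, hdc⟩ := W.exists_first _ hM
  have hcx : c ≤ x := by
    by_contra! hcon
    exact lt_irrefl _ (hcA y ⟨hy.1, hy.2.trans_lt hcon⟩)
  rcases eq_or_lt_of_le hcx with rfl | hlt
  · rw [hAc]
    exact ⟨hM, hdc, hsub, hcA⟩
  · exfalso
    have hder := (W.analytic c (hcJ ⟨hc0.le, le_rfl⟩)).differentiableAt.hasDerivAt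
    have h2 := (hasDerivAt_iff_tendsto_slope.1 hder).eventually (lt_mem_nhds hdc)
    have h3 : ∀ᶠ t in 𝓝[>] c, 0 < slope A c t :=
      h2.filter_mono (nhdsWithin_mono _ fun t (ht : c < t) => ht.ne')
    obtain ⟨z, hz, hz'⟩ := (h3.and (Ioo_mem_nhdsGT hlt)).exists
    rw [slope_def_field] at hz
    have h4 : 0 < A z - A c := (div_pos_iff_of_pos_right (sub_pos.2 hz'.1)).1 hz
    have h5 : A z ≤ A y := hmax ⟨hc0.le.trans hz'.1.le, hz'.2.le⟩
    linarith

lemma injOn (W : IsHalfWell A J h₀) {x y : ℝ} (hx : x ∈ J) (hx0 : 0 < x) (hy : y ∈ J)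
    (hy0 : 0 < y) (hxy : A x = A y) : x = y := by
  rcases lt_trichotomy x y with h | h | h
  · exact absurd hxy ((W.first_attained hy hy0).2.2.2 x ⟨hx0.le, h⟩).ne
  · exact h
  · exact absurd hxy ((W.first_attained hx hx0).2.2.2 y ⟨hy0.le, h⟩).ne'

/-- The inverse of `A` on one side of the well is analytic, and it turns integrals against powers
of `h - A` into fractional integrals. -/
lemma exists_inverse (W : IsHalfWell A J h₀) :
    ∃ ρ : ℝ → ℝ, AnalyticOnNhd ℝ ρ (realIoo 0 h₀) ∧
      (∀ h ∈ realIoo 0 h₀, 0 < ρ h ∧ ρ h ∈ J ∧ A (ρ h) = h) ∧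
      ∀ q : ℝ → ℝ, ContinuousOn q J → ∀ h ∈ realIoo 0 h₀,
        IntegrableOn (fun u => q (ρ u) / deriv A (ρ u)) (Ioo 0 h) ∧
        ∀ e : ℝ, 0 ≤ e → ∫ x in (0 : ℝ)..ρ h, q x * (h - A x) ^ e =
          fracIntegral e (fun u => q (ρ u) / deriv A (ρ u)) h := by
  choose! ρ hρ0 hρJ hρlt hρA hρd using W.exists_first
  have hρm : ∀ h ∈ realIoo 0 h₀, ρ h ∈ J := fun h hh => hρJ h hh ⟨(hρ0 h hh).le, le_rfl⟩
  have hinv : ∀ x ∈ J, 0 < x → ρ (A x) = x := fun x hx hx0 => by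
    have hT := (W.first_attained hx hx0).1
    exact W.injOn (hρm _ hT) (hρ0 _ hT) hx hx0 (hρA _ hT)
  refine ⟨ρ, fun h hh => ?_, fun h hh => ⟨hρ0 h hh, hρm h hh, hρA h hh⟩, fun q hq h hh => ?_⟩
  · have h1 : AnalyticAt ℝ (ρ ∘ A) (ρ h) := by
      refine analyticAt_id.congr ?_
      filter_upwards [W.isOpen.mem_nhds (hρm h hh), lt_mem_nhds (hρ0 h hh)] with x hx hx0
      exact (hinv x hx hx0).symm
    have h2 := (analyticAt_comp_iff_of_deriv_ne_zero (W.analytic _ (hρm h hh)) (hρd h hh).ne').1 h1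
    rwa [hρA h hh] at h2
  · set b := ρ h with hb
    have hb0 : 0 < b := hρ0 h hh
    have hsub : Icc 0 b ⊆ J := hρJ h hh
    have hsubo : Ioo 0 b ⊆ J := Ioo_subset_Icc_self.trans hsub
    have hmono : StrictMonoOn A (Icc 0 b) := fun x hx y hy hxy =>
      (W.first_attained (hsub hy) (hx.1.trans_lt hxy)).2.2.2 x ⟨hx.1, hxy⟩
    have himg : A '' Ioo 0 b = Ioo 0 h := by
      refine Subset.antisymm ?_ ?_
      · rintro _ ⟨x, hx, rfl⟩
        have h1 : (0 : ℝ) < A x := by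
          exact_mod_cast (W.first_attained (hsubo hx) hx.1).1.1
        exact ⟨h1, hρlt h hh x ⟨hx.1.le, hx.2⟩⟩
      · have h1 := intermediate_value_Ioo hb0.le (W.analytic.continuousOn.mono hsub)
        rwa [W.map_zero, hρA h hh] at h1
    have hd : ∀ x ∈ Ioo 0 b, HasDerivWithinAt A (deriv A x) (Ioo 0 b) x := fun x hx =>
      (W.analytic x (hsubo hx)).differentiableAt.hasDerivAt.hasDerivWithinAt
    have hinj : InjOn A (Ioo 0 b) := hmono.injOn.mono Ioo_subset_Icc_self
    have hpull : ∀ e : ℝ, ∀ x ∈ Ioo 0 b,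
        |deriv A x| • (q (ρ (A x)) / deriv A (ρ (A x)) * (h - A x) ^ e) =
          q x * (h - A x) ^ e := by
      intro e x hx
      have h1 := (W.first_attained (hsubo hx) hx.1).2.1
      rw [hinv x (hsubo hx) hx.1, abs_of_pos h1, smul_eq_mul]
      field_simp
    have hcont : ∀ e : ℝ, 0 ≤ e → ContinuousOn (fun x => q x * (h - A x) ^ e) (Icc 0 b) :=
      fun e he => (hq.mono hsub).mul ((continuousOn_const.sub
        (W.analytic.continuousOn.mono hsub)).rpow_const fun x _ => Or.inr he)
    refine ⟨?_, fun e he => ?_⟩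
    · have h1 : IntegrableOn (fun x => |deriv A x| •
          (fun u => q (ρ u) / deriv A (ρ u) * (h - u) ^ (0 : ℝ)) (A x)) (Ioo 0 b) := by
        refine (integrableOn_congr_fun (hpull 0) measurableSet_Ioo).2 ?_
        exact (hcont 0 le_rfl).integrableOn_Icc.mono_set Ioo_subset_Icc_self
      have h2 := (integrableOn_image_iff_integrableOn_abs_deriv_smul measurableSet_Ioo hd hinj
        fun u => q (ρ u) / deriv A (ρ u) * (h - u) ^ (0 : ℝ)).2 h1
      simpa [himg] using h2
    · rw [fracIntegral, intervalIntegral.integral_of_le hb0.le,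
        intervalIntegral.integral_of_le (by exact_mod_cast hh.1.le), integral_Ioc_eq_integral_Ioo,
        integral_Ioc_eq_integral_Ioo, ← himg,
        integral_image_eq_integral_abs_deriv_smul measurableSet_Ioo hd hinj]
      exact (setIntegral_congr_fun measurableSet_Ioo (hpull e)).symm

end IsHalfWell

/-! ### Reduction of the line integrals to fractional integrals -/

section Reduction

variable {A B σ : ℝ → ℝ} {m : ℕ} {P : Set (ℝ × ℝ)} {h₀ xl xr : EReal} {γ : ℝ → ℝ → ℝ × ℝ}

lemma A_pos_of_mem_annulus (hm : 1 ≤ m)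
    (hP : IsPeriodAnnulus (fun p : ℝ × ℝ => A p.1 + B p.1 * p.2 ^ (2 * m)) P h₀ γ) :
    ∀ᶠ x in 𝓝[≠] (0 : ℝ), 0 < A x := by
  filter_upwards [eventually_mem_annulus hP (g := fun x => (x, (0 : ℝ))) (by fun_prop) rfl
    fun x hx h => hx (congrArg Prod.fst h)] with x hx
  obtain ⟨h, hh, t, ht⟩ := (mem_iff_exists_oval hP).1 hx
  have h1 := (hP.oval h hh).level t
  have h2 : (0 : ℝ) < h := by exact_mod_cast hh.1
  have h3 : 2 * m ≠ 0 := by omega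
  simp only [ht, zero_pow h3, mul_zero, add_zero] at h1
  rwa [h1]

lemma isHalfWell_right (hm : 1 ≤ m)
    (hP : IsPeriodAnnulus (fun p : ℝ × ℝ => A p.1 + B p.1 * p.2 ^ (2 * m)) P h₀ γ)
    (hproj : Prod.fst '' P = realIoo xl xr) (hA : AnalyticOnNhd ℝ A (realIoo xl xr))
    (hB : AnalyticOnNhd ℝ B (realIoo xl xr)) : IsHalfWell A (realIoo xl xr) h₀ where
  isOpen := isOpen_realIoo _ _
  analytic := hA
  map_zero := A_zero_eq_zero hm hP
  eventually_pos := (A_pos_of_mem_annulus hm hP).filter_mono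
    (nhdsWithin_mono _ fun _ (hx : 0 < _) => hx.ne')
  exists_first := by
    intro h hh
    obtain ⟨a, b, ha, hb, hsub, hlt, -, hAb, -, hd, -⟩ := exists_oval_extent hm hP hproj hA hB hh
    exact ⟨b, hb, (Icc_subset_Icc_left ha.le).trans hsub,
      fun x hx => hlt x ⟨ha.trans_le hx.1, hx.2⟩, hAb, hd⟩
  exhausted := by
    intro x hx hx0
    rw [← hproj] at hx
    obtain ⟨p, hp, rfl⟩ := hx
    obtain ⟨h, hh, t, rfl⟩ := (mem_iff_exists_oval hP).1 hp
    obtain ⟨a, b, ha, hb, hsub, hlt, -, hAb, -, -, hmem, -⟩ :=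
      exists_oval_extent hm hP hproj hA hB hh
    exact ⟨h, hh, b, (hmem t).2, (Icc_subset_Icc_left ha.le).trans hsub,
      fun x hx => hlt x ⟨ha.trans_le hx.1, hx.2⟩, hAb⟩

lemma isHalfWell_left (hm : 1 ≤ m)
    (hP : IsPeriodAnnulus (fun p : ℝ × ℝ => A p.1 + B p.1 * p.2 ^ (2 * m)) P h₀ γ)
    (hproj : Prod.fst '' P = realIoo xl xr) (hA : AnalyticOnNhd ℝ A (realIoo xl xr))
    (hB : AnalyticOnNhd ℝ B (realIoo xl xr)) :
    IsHalfWell (fun x => A (-x)) {x | -x ∈ realIoo xl xr} h₀ where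
  isOpen := (isOpen_realIoo _ _).preimage continuous_neg
  analytic := fun x hx => AnalyticAt.comp (f := fun x : ℝ => -x) (hA _ hx) (by fun_prop)
  map_zero := by simpa using A_zero_eq_zero hm hP
  eventually_pos := by
    refine Tendsto.eventually (f := fun x : ℝ => -x) ?_ (A_pos_of_mem_annulus hm hP)
    refine tendsto_nhdsWithin_iff.2 ⟨?_, ?_⟩
    · exact (by simpa using (continuous_neg (G := ℝ)).tendsto 0 :
        Tendsto (fun x : ℝ => -x) (𝓝 0) (𝓝 0)).mono_left nhdsWithin_le_nhds
    · filter_upwards [self_mem_nhdsWithin] with x hx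
      exact neg_ne_zero.2 (ne_of_gt hx)
  exists_first := by
    intro h hh
    obtain ⟨a, b, ha, hb, hsub, hlt, hAa, -, hd, -⟩ := exists_oval_extent hm hP hproj hA hB hh
    refine ⟨-a, neg_pos.2 ha, fun x hx => hsub ⟨by linarith [hx.2], by linarith [hx.1]⟩,
      fun x hx => hlt _ ⟨by linarith [hx.2], by linarith [hx.1]⟩, by rw [neg_neg, hAa], ?_⟩
    rw [deriv_comp_neg, neg_neg]
    exact neg_pos.2 hd
  exhausted := by
    intro x hx hx0
    rw [mem_ofPred_eq, ← hproj] at hx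
    obtain ⟨p, hp, hpx⟩ := hx
    obtain ⟨h, hh, t, rfl⟩ := (mem_iff_exists_oval hP).1 hp
    obtain ⟨a, b, ha, hb, hsub, hlt, hAa, -, -, -, hmem, -⟩ :=
      exists_oval_extent hm hP hproj hA hB hh
    refine ⟨h, hh, -a, by linarith [(hmem t).1],
      fun x hx => hsub ⟨by linarith [hx.2], by linarith [hx.1]⟩,
      fun x hx => hlt _ ⟨by linarith [hx.2], by linarith [hx.1]⟩, by rw [neg_neg, hAa]⟩

/-- The involution exchanges the two sides of the well: on the right side it is either the
identity or negative, and in the first case it would be the identity everywhere. -/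
lemma involution_neg (hA0 : A 0 = 0) (W : IsHalfWell A (realIoo xl xr) h₀)
    (h0 : (0 : ℝ) ∈ realIoo xl xr) (hσ : IsInvolutionOf A σ (realIoo xl xr)) :
    ∀ x ∈ realIoo 0 xr, σ x < 0 := by
  have hsub : realIoo 0 xr ⊆ realIoo xl xr := fun x hx => ⟨h0.1.trans hx.1, hx.2⟩
  have hpos : ∀ x ∈ realIoo 0 xr, 0 < x := fun x hx => by exact_mod_cast hx.1
  have hne : ∀ x ∈ realIoo 0 xr, σ x ≠ 0 := by
    intro x hx h1
    have h2 : (0 : ℝ) < A x := by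
      exact_mod_cast (W.first_attained (hsub hx) (hpos x hx)).1.1
    rw [← hσ.invariant x (hsub hx), h1, hA0] at h2
    exact lt_irrefl _ h2
  by_contra! hcon
  obtain ⟨x, hx, hσx⟩ := hcon
  have hallpos : ∀ y ∈ realIoo 0 xr, 0 < σ y := by
    intro y hy
    by_contra! hy0
    obtain ⟨z, hz, hz0⟩ := (ordConnected_realIoo 0 xr).isPreconnected.intermediate_value hy hx
      (hσ.analytic.continuousOn.mono hsub) ⟨hy0, hσx⟩
    exact hne z hz hz0
  have hid : ∀ y ∈ realIoo 0 xr, σ y = y := fun y hy =>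
    W.injOn (hσ.mapsTo (hsub hy)) (hallpos y hy) (hsub hy) (hpos y hy) (hσ.invariant y (hsub hy))
  obtain ⟨z, hz, hσz⟩ := hσ.ne_id
  refine hσz (hσ.analytic.eqOn_of_preconnected_of_eventuallyEq (g := id)
    (fun _ _ => analyticAt_id) (ordConnected_realIoo _ _).isPreconnected (hsub hx) ?_ hz)
  filter_upwards [(isOpen_realIoo 0 xr).mem_nhds hx] with y hy using hid y hy

lemma intervalIntegrable_mul_sub_rpow_of_nonneg {L : ℝ → ℝ} {e h : ℝ} (he : 0 ≤ e) (hh : 0 ≤ h)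
    (hi : IntegrableOn L (Ioo 0 h)) :
    IntervalIntegrable (fun u => L u * (h - u) ^ e) volume 0 h :=
  ((intervalIntegrable_iff_integrableOn_Ioo_of_le hh).2 hi).mul_continuousOn
    (ContinuousOn.rpow_const (by fun_prop) fun _ _ => Or.inr he)

/-- The line integrals are fractional integrals of the balances, transported to the energy axis by
the inverse `ρ` of `A` on `(0, xr)`. -/
lemma exists_lineIntegral_eq_fracIntegral {s : ℕ} (hm : 1 ≤ m) (hs : 1 ≤ s)
    (hP : IsPeriodAnnulus (fun p : ℝ × ℝ => A p.1 + B p.1 * p.2 ^ (2 * m)) P h₀ γ)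
    (hproj : Prod.fst '' P = realIoo xl xr) (hA : AnalyticOnNhd ℝ A (realIoo xl xr))
    (hB : AnalyticOnNhd ℝ B (realIoo xl xr)) (hσ : IsInvolutionOf A σ (realIoo xl xr)) {e : ℝ}
    (he : e = (2 * (s : ℝ) - 1) / (2 * (m : ℝ))) :
    ∃ ρ : ℝ → ℝ, AnalyticOnNhd ℝ ρ (realIoo 0 h₀) ∧ MapsTo ρ (realIoo 0 h₀) (realIoo 0 xr) ∧
      InjOn ρ (realIoo 0 h₀) ∧
      ∀ f : ℝ → ℝ, ContinuousOn f (realIoo xl xr) → ∀ h ∈ realIoo 0 h₀,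
        IntegrableOn (fun u => balance σ (fun x => f x / (deriv A x * B x ^ e)) (ρ u)) (Ioo 0 h) ∧
        lineIntegral f (fun y => y ^ (2 * s - 1)) (γ h) =
          2 * fracIntegral e
            (fun u => balance σ (fun x => f x / (deriv A x * B x ^ e)) (ρ u)) h := by
  have W := isHalfWell_right hm hP hproj hA hB
  have W' := isHalfWell_left hm hP hproj hA hB
  have h0 := zero_mem_realIoo hP hproj
  have hBpos := B_pos hm hP hproj hA hB
  obtain ⟨ρ, hρ, hρm, hρi⟩ := W.exists_inverse
  obtain ⟨τ, -, hτm, hτi⟩ := W'.exists_inverse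
  have hρR : MapsTo ρ (realIoo 0 h₀) (realIoo 0 xr) := fun h hh =>
    ⟨by exact_mod_cast (hρm h hh).1, (hρm h hh).2.1.2⟩
  have he0 : 0 ≤ e := by
    have hs1 : (1 : ℝ) ≤ s := by exact_mod_cast hs
    rw [he]
    apply div_nonneg
    · linarith
    · positivity
  have hστ : ∀ u ∈ realIoo 0 h₀, σ (ρ u) = -τ u := by
    intro u hu
    have hneg := involution_neg (A_zero_eq_zero hm hP) W h0 hσ _ (hρR hu)
    have hmem := hσ.mapsTo (hρm u hu).2.1
    have h1 := W'.injOn (x := -σ (ρ u)) (y := τ u) (by simpa using hmem) (by linarith)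
      (hτm u hu).2.1 (hτm u hu).1
      (by rw [neg_neg, hσ.invariant _ (hρm u hu).2.1, (hρm u hu).2.2, (hτm u hu).2.2])
    linarith
  refine ⟨ρ, hρ, hρR, fun u hu v hv huv => by rw [← (hρm u hu).2.2, huv, (hρm v hv).2.2],
    fun f hf h hh => ?_⟩
  have hpos : (0 : ℝ) < h := by exact_mod_cast hh.1
  have hIoo : Ioo 0 h ⊆ realIoo 0 h₀ := fun u hu =>
    ⟨by exact_mod_cast hu.1, (EReal.coe_lt_coe_iff.2 hu.2).trans hh.2⟩
  set q : ℝ → ℝ := fun x => f x / B x ^ e with hq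
  have hqc : ContinuousOn q (realIoo xl xr) := hf.div
    (hB.continuousOn.rpow_const fun x hx => Or.inl (hBpos x hx).ne')
    fun x hx => (Real.rpow_pos_of_pos (hBpos x hx) e).ne'
  have hqc' : ContinuousOn (fun x => q (-x)) {x | -x ∈ realIoo xl xr} :=
    hqc.comp continuous_neg.continuousOn fun x hx => hx
  obtain ⟨hi, hfrac⟩ := hρi q hqc h hh
  obtain ⟨hi', hfrac'⟩ := hτi _ hqc' h hh
  have hbal : ∀ u ∈ Ioo 0 h, balance σ (fun x => f x / (deriv A x * B x ^ e)) (ρ u) =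
      q (ρ u) / deriv A (ρ u) + q (-τ u) / deriv (fun x => A (-x)) (τ u) := by
    intro u hu
    rw [balance, hστ u (hIoo hu), deriv_comp_neg]
    simp only [hq]
    rw [div_neg, ← sub_eq_add_neg, div_div, div_div, mul_comm (B (ρ u) ^ e),
      mul_comm (B (-τ u) ^ e)]
  refine ⟨(integrableOn_congr_fun hbal measurableSet_Ioo).2 (hi.add hi'), ?_⟩
  obtain ⟨a, b, ha, hb, hsub, hlt, hAa, hAb, -, -, -, hint⟩ :=
    exists_oval_extent hm hP hproj hA hB hh
  have hbρ : b = ρ h := W.injOn (hsub ⟨(ha.trans hb).le, le_rfl⟩) hb (hρm h hh).2.1 (hρm h hh).1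
    (hAb.trans (hρm h hh).2.2.symm)
  have haτ : -a = τ h := W'.injOn (x := -a)
    (by rw [mem_ofPred_eq, neg_neg]; exact hsub ⟨le_rfl, (ha.trans hb).le⟩) (neg_pos.2 ha)
    (hτm h hh).2.1 (hτm h hh).1 (by rw [neg_neg, hAa, (hτm h hh).2.2])
  have hintegrand : ∀ x ∈ Icc a b, f x * ((h - A x) / B x) ^ e = q x * (h - A x) ^ e := by
    intro x hx
    have h1 : A x ≤ h := by
      rcases eq_or_lt_of_le hx.1 with rfl | h1
      · exact hAa.le
      · rcases eq_or_lt_of_le hx.2 with rfl | h2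
        · exact hAb.le
        · exact (hlt x ⟨h1, h2⟩).le
    rw [Real.div_rpow (by linarith) (hBpos x (hsub hx)).le, hq]
    ring
  have hcont : ContinuousOn (fun x => q x * (h - A x) ^ e) (Icc a b) :=
    ((hqc.mul ((continuousOn_const.sub hA.continuousOn).rpow_const
      fun x _ => Or.inr he0))).mono hsub
  have hii : ∀ c ∈ Icc a b, ∀ d ∈ Icc a b,
      IntervalIntegrable (fun x => q x * (h - A x) ^ e) volume c d := fun c hc d hd =>
    (hcont.mono (uIcc_subset_Icc hc hd)).intervalIntegrable
  have hab : a ≤ b := (ha.trans hb).le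
  have hleft : ∫ x in a..0, q x * (h - A x) ^ e =
      ∫ x in (0 : ℝ)..τ h, q (-x) * (h - A (-x)) ^ e := by
    rw [← haτ, intervalIntegral.integral_comp_neg (fun x => q x * (h - A x) ^ e), neg_neg, neg_zero]
  rw [hint f hf s hs, ← he, intervalIntegral.integral_congr (g := fun x => q x * (h - A x) ^ e)
      (by rw [uIcc_of_le hab]; exact hintegrand),
    ← intervalIntegral.integral_add_adjacent_intervals
      (hii a ⟨le_rfl, hab⟩ 0 ⟨ha.le, hb.le⟩) (hii 0 ⟨ha.le, hb.le⟩ b ⟨hab, le_rfl⟩),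
    hleft, hbρ, hfrac e he0, hfrac' e he0]
  congr 1
  rw [add_comm, fracIntegral, fracIntegral,
    ← intervalIntegral.integral_add (intervalIntegrable_mul_sub_rpow_of_nonneg he0 hpos.le hi)
      (intervalIntegrable_mul_sub_rpow_of_nonneg he0 hpos.le hi'), fracIntegral,
    intervalIntegral.integral_of_le hpos.le, intervalIntegral.integral_of_le hpos.le,
    integral_Ioc_eq_integral_Ioo, integral_Ioc_eq_integral_Ioo]
  refine setIntegral_congr_fun measurableSet_Ioo fun u hu => ?_
  simp only [hbal u hu]
  ring

end Reduction

/-! ### The Chebyshev property of the line integrals -/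

theorem theoremB (n m s : ℕ) (hm : 1 ≤ m) (hs : 1 ≤ s)
    (A B σ : ℝ → ℝ) (f : Fin n → ℝ → ℝ)
    (P : Set (ℝ × ℝ)) (h₀ xl xr : EReal) (γ : ℝ → ℝ → ℝ × ℝ)
    -- the ovals `γ_h`, `0 < h < h₀`, of `H(x, y) = A(x) + B(x) y ^ (2m)` foliate `P`
    (hP : IsPeriodAnnulus (fun p : ℝ × ℝ => A p.1 + B p.1 * p.2 ^ (2 * m)) P h₀ γ)
    -- `(xl, xr)` is the projection of `P` on the `x`-axis
    (hproj : Prod.fst '' P = realIoo xl xr)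
    (hA : AnalyticOnNhd ℝ A (realIoo xl xr))
    (hB : AnalyticOnNhd ℝ B (realIoo xl xr))
    (hf : ∀ i, AnalyticOnNhd ℝ (f i) (realIoo xl xr))
    (hσ : IsInvolutionOf A σ (realIoo xl xr))
    (hsn : (s : ℤ) > (m : ℤ) * ((n : ℤ) - 2))
    (hCT : IsCTSystem
      (fun i => balance σ (fun x =>
        f i x / (deriv A x * B x ^ ((2 * (s : ℝ) - 1) / (2 * (m : ℝ))))))
      (realIoo 0 xr)) :
    IsECTSystem (fun i h => lineIntegral (f i) (fun y => y ^ (2 * s - 1)) (γ h))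
      (realIoo 0 h₀) := by
  obtain ⟨ρ, hρ, hρR, hρinj, hred⟩ :=
    exists_lineIntegral_eq_fracIntegral (s := s) hm hs hP hproj hA hB hσ rfl
  set e : ℝ := (2 * (s : ℝ) - 1) / (2 * (m : ℝ)) with he
  have hm0 : (0 : ℝ) < m := by exact_mod_cast hm
  have hs1 : (1 : ℝ) ≤ s := by exact_mod_cast hs
  have he0 : 0 ≤ e := by rw [he]; apply div_nonneg <;> linarith
  -- `s > m (n - 2)` means `s ≥ m (n - 2) + 1`, hence `e > n - 2`
  have hen : (n : ℝ) - 2 < e := by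
    have h1 : (m : ℝ) * ((n : ℝ) - 2) + 1 ≤ s := by exact_mod_cast Int.add_one_le_iff.2 hsn
    rw [he, lt_div_iff₀ (by linarith)]
    linarith
  set ℓ : Fin n → ℝ → ℝ := fun i => balance σ (fun x => f i x / (deriv A x * B x ^ e)) with hℓ
  set L : Fin n → ℝ → ℝ := fun i u => ℓ i (ρ u) with hL
  have hLan : ∀ i, AnalyticOnNhd ℝ (L i) (realIoo 0 h₀) := fun i u hu =>
    ((hCT n (Fin.pos i) le_rfl).1 i _ (hρR hu)).comp (hρ u hu)
  have hLint : ∀ i, ∀ h ∈ realIoo 0 h₀, IntegrableOn (L i) (Ioo 0 h) := fun i h hh =>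
    (hred (f i) (hf i).continuousOn h hh).1
  have hI : ∀ i, ∀ h ∈ realIoo 0 h₀,
      lineIntegral (f i) (fun y => y ^ (2 * s - 1)) (γ h) = 2 * fracIntegral e (L i) h :=
    fun i h hh => (hred (f i) (hf i).continuousOn h hh).2
  have hopen := isOpen_realIoo 0 h₀
  have hpos : ∀ h ∈ realIoo 0 h₀, (0 : ℝ) < h := fun h hh => by exact_mod_cast hh.1
  have hlarger : ∀ h ∈ realIoo 0 h₀, ∃ H ∈ realIoo 0 h₀, h < H := by
    intro h hh
    have h1 : ∀ᶠ H in 𝓝[>] h, H ∈ realIoo 0 h₀ := mem_nhdsWithin_of_mem_nhds (hopen.mem_nhds hh)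
    exact (h1.and self_mem_nhdsWithin).exists
  have hsub : ∀ H ∈ realIoo 0 h₀, Ioo 0 H ⊆ realIoo 0 h₀ := fun H hH u hu =>
    ⟨by exact_mod_cast hu.1, (EReal.coe_lt_coe_iff.2 hu.2).trans hH.2⟩
  refine isECTSystem_of_order_lt hopen (ordConnected_realIoo _ _) (fun i h hh => ?_)
    fun k hk α hα h hh => ?_
  · obtain ⟨H, hH, hhH⟩ := hlarger h hh
    have h1 := analyticOnNhd_fracIntegral (a := e) (by linarith) ((hLan i).mono (hsub H hH))
      (hLint i H hH) h ⟨hpos h hh, hhH⟩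
    refine (analyticAt_const.mul h1 : AnalyticAt ℝ (fun h => 2 * fracIntegral e (L i) h) h).congr ?_
    filter_upwards [hopen.mem_nhds hh] with x hx using (hI i x hx).symm
  · obtain ⟨H, hH, hhH⟩ := hlarger h hh
    have hk1 : 1 ≤ k := by
      by_contra! hk0
      obtain rfl : k = 0 := by omega
      exact hα (Subsingleton.elim _ _)
    set Λ : ℝ → ℝ := fun u => ∑ i, α i * L (Fin.castLE hk i) u with hΛ
    have hΛan : AnalyticOnNhd ℝ Λ (Ioo 0 H) := fun u hu =>
      Finset.analyticAt_fun_sum _ fun i _ => analyticAt_const.mul (hLan _ u (hsub H hH hu))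
    have hΛint : IntegrableOn Λ (Ioo 0 H) :=
      integrable_finsetSum _ fun i _ => (hLint _ H hH).const_mul _
    -- `ρ` carries the zeros of `Λ` to zeros of the combination of balances
    have hzeros : {u ∈ Ioo 0 H | Λ u = 0}.encard ≤ ((k - 1 : ℕ) : ℕ∞) := by
      refine le_trans ?_ ((hCT k hk1 hk).2 α hα)
      refine encard_le_encard_of_injOn (f := ρ) (fun u hu => ⟨hρR (hsub H hH hu.1), hu.2⟩) ?_
      exact hρinj.mono fun u hu => hsub H hH hu.1
    have hek : -1 < e - ((k - 1 : ℕ) : ℝ) := by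
      have h1 : (k : ℝ) ≤ n := by exact_mod_cast hk
      rw [Nat.cast_sub hk1]
      push_cast
      linarith
    have hord := analyticOrderAt_fracIntegral_le hΛan hΛint ⟨hpos h hh, hhH⟩ hek hzeros
    rw [sub_add_cancel, Nat.sub_add_cancel hk1] at hord
    have hcomb : (fun x => ∑ i, α i * lineIntegral (f (Fin.castLE hk i))
        (fun y => y ^ (2 * s - 1)) (γ x)) =ᶠ[𝓝 h] ((fun _ => (2 : ℝ)) * fracIntegral e Λ) := by
      filter_upwards [hopen.mem_nhds hh] with x hx
      have h2 : fracIntegral e Λ x = ∑ i, α i * fracIntegral e (L (Fin.castLE hk i)) x := by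
        simp only [fracIntegral, hΛ, Finset.sum_mul, mul_assoc]
        rw [intervalIntegral.integral_finsetSum fun i _ =>
          (intervalIntegrable_mul_sub_rpow_of_nonneg he0 (hpos x hx).le (hLint _ x hx)).const_mul _]
        simp only [intervalIntegral.integral_const_mul]
      rw [Pi.mul_apply, h2, Finset.mul_sum]
      refine Finset.sum_congr rfl fun i _ => ?_
      rw [hI _ x hx]
      ring
    rw [analyticOrderAt_congr hcomb, analyticOrderAt_mul analyticAt_const
      (analyticOnNhd_fracIntegral (by linarith) hΛan hΛint h ⟨hpos h hh, hhH⟩),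
      (analyticAt_const.analyticOrderAt_eq_zero).2 two_ne_zero, zero_add]
    exact hord
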